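/- Let $(M,J,g)$ be a smooth almost Norden manifold of dimension $2n$: $g$ is a smooth pseudo-Riemannian metric and $J$ a smooth almost complex structure with $g(JX,JY)=-g(X,Y)$ (so $g$ has signature $(n,n)$). Let $\nabla$ be the Levi-Civita connection of $g$, $R(X,Y)Z=\nabla_X\nabla_YZ-\nabla_Y\nabla_XZ-\nabla_{[X,Y]}Z$ and $R(x,y,z,w)=g(R(x,y)z,w)$. Put $F(x,y,z)=g((\nabla_xJ)y,z)$ and let $$\theta(z)=g^{ij}F(e_i,e_j,z),\qquad \rho(y,z)=g^{ij}R(e_i,y,z,e_j),\qquad \rho^*(y,z)=g^{ij}R(e_i,y,z,Je_j)$$ be the Lee form, the Ricci tensor and the associated Ricci tensor of $M$, where $(e_i)$ is any basis of the tangent space, $g_{ij}=g(e_i,e_j)$ and $(g^{ij})=(g_{ij})^{-1}$. For a vector field $X$ on $M$ let $X^V$ and $X^H$ be its vertical lift and its horizontal lift with respect to $\nabla$ to the tangent bundle $TM$. Let $\hat g$ be the complete lift of $g$ to $TM$, that is, $$\hat g(X^H,Y^H)=\hat g(X^V,Y^V)=0,\qquad \hat g(X^H,Y^V)=\hat g(X^V,Y^H)=g(X,Y),$$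 and let $J_1,J_2,J_3$ be the almost complex structures on $TM$ given by $$J_1X^H=-(JX)^H,\quad J_1X^V=(JX)^V;\qquad J_2X^H=X^V,\quad J_2X^V=-X^H;\qquad J_3X^H=(JX)^V,\quad J_3X^V=(JX)^H.$$ Let $\hat\nabla$ be the Levi-Civita connection of $\hat g$, $F_\alpha(\xi,\eta,\zeta)=\hat g((\hat\nabla_\xi J_\alpha)\eta,\zeta)$, and let $\theta_\alpha(\zeta)=\hat g^{AB}F_\alpha(\hat e_A,\hat e_B,\zeta)$ be the corresponding Lee forms, where $(\hat e_A)$ is any basis of the tangent space of $TM$ at the given point and $(\hat g^{AB})$ is the inverse of the matrix $(\hat g(\hat e_A,\hat e_B))$ ($\alpha=1,2,3$). Then: (i) $\theta_1=0$ on $TM$ if and only if $\theta=0$ on $M$; (ii) $\theta_2=0$ on $TM$ if and only if $\rho=0$ on $M$; (iii) $\theta_3=0$ on $TM$ if and only if $\theta=0$ and $\rho^*=0$ on $M$. -/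

import Mathlib

set_option maxSynthPendingDepth 3

open Bundle Manifold ContDiff

noncomputable section

namespace AlmostNorden

section Pointwise

variable {V W : Type*} [AddCommGroup V] [Module ℝ V] [TopologicalSpace V]
  [AddCommGroup W] [Module ℝ W] [TopologicalSpace W]

/-- The bilinear form `(v, w) ↦ B (a v) (b w)`. -/
def pullForm (B : W →L[ℝ] W →L[ℝ] ℝ) (a b : V →L[ℝ] W) : V →L[ℝ] V →L[ℝ] ℝ :=
  (ContinuousLinearMap.precomp ℝ b).comp (B.comp a)

@[simp]
theorem pullForm_apply (B : W →L[ℝ] W →L[ℝ] ℝ) (a b : V →L[ℝ] W) (v w : V) :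
    pullForm B a b v w = B (a v) (b w) := rfl

/-- The trace `g^{ij} B(e_i, e_j)` of `B` with respect to the form `g`, where `(e_i)` is a basis and
`(g^{ij})` is the inverse of the matrix `(g(e_i, e_j))`. For a nondegenerate form `g` and a
bilinear `B` it does not depend on the basis. -/
def metricTrace [FiniteDimensional ℝ V] (g : V →L[ℝ] V →L[ℝ] ℝ) (B : V → V → ℝ) : ℝ :=
  letI e := Module.finBasis ℝ V
  ∑ i, ∑ j, (Matrix.of fun k l ↦ g (e k) (e l))⁻¹ i j * B (e i) (e j)

end Pointwise

section Manifold

variable {E : Type*} [NormedAddCommGroup E] [NormedSpace ℝ E]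
  {H : Type*} [TopologicalSpace H] {I : ModelWithCorners ℝ E H}
  {M : Type*} [TopologicalSpace M] [ChartedSpace H M]

variable (I M) in
/-- Fields of bilinear forms on the tangent spaces, that is, `(0,2)`-tensor fields. -/
abbrev FormField := Π p : M, TangentSpace I p →L[ℝ] TangentSpace I p →L[ℝ] ℝ

variable (I M) in
/-- Fields of endomorphisms of the tangent spaces, that is, `(1,1)`-tensor fields. -/
abbrev EndField := Π p : M, TangentSpace I p →L[ℝ] TangentSpace I p

variable [IsManifold I 1 M]

/-! ### The Levi-Civita connection -/

/-- The frame of coordinate vector fields of the preferred chart at `p`: `frame p q a` is the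
vector at `q` with the constant components `a` in that chart. -/
def frame (p q : M) : E →L[ℝ] TangentSpace I q :=
  (trivializationAt E (TangentSpace I : M → Type _) p).symmL ℝ q

/-- The components in the preferred chart at `p` of a vector at `q`. -/
def components (p q : M) : TangentSpace I q →L[ℝ] E :=
  (trivializationAt E (TangentSpace I : M → Type _) p).continuousLinearMapAt ℝ q

/-- The components `g_{ij}`, in the preferred chart at `p`, of a field `g` of bilinear forms. -/
def metricComponents (g : FormField I M)
    (p q : M) : E →L[ℝ] E →L[ℝ] ℝ :=
  pullForm (g q) (frame p q) (frame p q)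

/-- The derivatives `∂_k g_{ij}` at `p`, in the preferred chart at `p`; the first argument is the
direction of differentiation. -/
def metricDerivative (g : FormField I M)
    (p : M) : E →L[ℝ] E →L[ℝ] E →L[ℝ] ℝ :=
  (mvfderiv I (metricComponents g p) p).comp (frame p p)

/-- The Christoffel symbols of the first kind
`(a, b, c) ↦ (∂_a g(b, c) + ∂_b g(a, c) - ∂_c g(a, b)) / 2` at `p`, in the preferred chart
at `p`. -/
def christoffelFirst (g : FormField I M)
    (p : M) (a : E) : E →L[ℝ] E →L[ℝ] ℝ :=
  (2⁻¹ : ℝ) • (metricDerivative g p a + (metricDerivative g p).flip a -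
    ((metricDerivative g p).flip a).flip)

theorem christoffelFirst_apply (g : FormField I M)
    (p : M) (a b c : E) :
    christoffelFirst g p a b c =
      2⁻¹ * (metricDerivative g p a b c + metricDerivative g p b a c
        - metricDerivative g p c a b) := by
  simp [christoffelFirst]

/-- The Christoffel symbols (of the second kind) at `p`, in the preferred chart at `p`. -/
def christoffel (g : FormField I M)
    (p : M) (a : E) : E →L[ℝ] E :=
  (metricComponents g p p).inverse.comp (christoffelFirst g p a)

theorem christoffel_add (g : FormField I M)
    (p : M) (a b : E) : christoffel g p (a + b) = christoffel g p a + christoffel g p b := by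
  ext c
  simp only [christoffel, ContinuousLinearMap.comp_apply, _root_.add_apply,
    ← map_add]
  congr 1
  ext d
  simp only [christoffelFirst_apply, _root_.add_apply, map_add]
  ring

theorem christoffel_smul (g : FormField I M)
    (p : M) (r : ℝ) (a : E) : christoffel g p (r • a) = r • christoffel g p a := by
  ext c
  simp only [christoffel, ContinuousLinearMap.comp_apply, _root_.smul_apply,
    ← map_smul]
  congr 1
  ext d
  simp only [christoffelFirst_apply, _root_.smul_apply, map_smul, smul_eq_mul]
  ring

theorem eventually_components (p : M) (σ : Π q : M, TangentSpace I q) :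
    (fun q ↦ (trivializationAt E (TangentSpace I : M → Type _) p ⟨q, σ q⟩).2) =ᶠ[nhds p]
      fun q ↦ components p q (σ q) := by
  filter_upwards [(trivializationAt E (TangentSpace I : M → Type _) p).open_baseSet.mem_nhds
    (FiberBundle.mem_baseSet_trivializationAt' p)] with q hq
  exact (Trivialization.continuousLinearMapAt_apply_of_mem ℝ _ hq _).symm

theorem mdifferentiableAt_components {p : M} {σ : Π q : M, TangentSpace I q}
    (hσ : MDifferentiableAt I (I.prod 𝓘(ℝ, E)) (fun q ↦ TotalSpace.mk' E q (σ q)) p) :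
    MDifferentiableAt I 𝓘(ℝ, E) (fun q ↦ components p q (σ q)) p :=
  ((mdifferentiableAt_section I σ).1 hσ).congr_of_eventuallyEq (eventually_components p σ).symm

theorem frame_components (p : M) (x : TangentSpace I p) : frame p p (components p p x) = x :=
  Trivialization.symmL_continuousLinearMapAt _ (FiberBundle.mem_baseSet_trivializationAt' p) x

theorem components_frame (p : M) (a : E) : components (I := I) p p (frame p p a) = a :=
  Trivialization.continuousLinearMapAt_symmL _ (FiberBundle.mem_baseSet_trivializationAt' p) a

/-- The Levi-Civita connection of a pseudo-Riemannian metric `g`. In the preferred chart at `p`,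
`(∇_x σ)^k = x^i ∂_i σ^k + Γ^k_{ij} x^i σ^j`. As in Mathlib, `leviCivita g σ p x` is `∇_x σ`
at the point `p`. -/
def leviCivita (g : FormField I M) :
    CovariantDerivative I E (TangentSpace I : M → Type _) where
  toFun σ p := (frame p p).comp
    (mvfderiv I (fun q ↦ components p q (σ q)) p +
      (christoffel g p (components p p (σ p))).comp (components p p))
  isCovariantDerivativeOnUniv :=
    { add := by
        intro σ σ' p hσ hσ' _
        ext x
        have h := mvfderiv_fun_add (mdifferentiableAt_components hσ)
          (mdifferentiableAt_components hσ')
        simp only [Pi.add_apply, map_add, h, christoffel_add, ContinuousLinearMap.comp_apply,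
          _root_.add_apply]
        abel
      leibniz := by
        intro σ f p hσ hf _
        ext x
        have h := mvfderiv_fun_smul hf (mdifferentiableAt_components hσ)
        simp only [Pi.smul_apply', map_smul, h, christoffel_smul, ContinuousLinearMap.comp_apply,
          _root_.add_apply, _root_.smul_apply, map_add,
          ContinuousLinearMap.smulRight_apply, frame_components]
        module }

/-- The covariant derivative `(∇_x A) y = ∇_x (A Y) - A (∇_x Y)` at `p` of a field `A` of
endomorphisms, where `Y` is a vector field that is smooth near `p` and has the value `y` at `p`. -/
def covDerivEnd (cov : CovariantDerivative I E (TangentSpace I : M → Type _))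
    (A : EndField I M) (p : M) (x y : TangentSpace I p) : TangentSpace I p :=
  letI Y : Π q : M, TangentSpace I q := FiberBundle.extend E y
  cov (fun q ↦ A q (Y q)) p x - A p (cov Y p x)

/-- The curvature `R(x, y) z = ∇_x ∇_y Z - ∇_y ∇_x Z - ∇_{[X, Y]} Z` at `p`, where `X`, `Y`, `Z`
are vector fields that are smooth near `p` and have the values `x`, `y`, `z` at `p`. -/
def curvature (cov : CovariantDerivative I E (TangentSpace I : M → Type _))
    (p : M) (x y z : TangentSpace I p) : TangentSpace I p :=
  letI X : Π q : M, TangentSpace I q := FiberBundle.extend E x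
  letI Y : Π q : M, TangentSpace I q := FiberBundle.extend E y
  letI Z : Π q : M, TangentSpace I q := FiberBundle.extend E z
  cov (fun q ↦ cov Z q (Y q)) p x - cov (fun q ↦ cov Z q (X q)) p y
    - cov Z p (VectorField.mlieBracket I X Y p)

variable [FiniteDimensional ℝ E]

instance instFiniteDimensionalTangentSpace (p : M) : FiniteDimensional ℝ (TangentSpace I p) :=
  inferInstanceAs (FiniteDimensional ℝ E)

instance instT2SpaceTangentSpace (p : M) : T2Space (TangentSpace I p) :=
  inferInstanceAs (T2Space E)

/-! ### Tensors of a metric and a field of endomorphisms -/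

/-- The structure tensor `F(x, y, z) = g((∇_x A) y, z)`, with `∇` the Levi-Civita connection
of `g`. -/
def structureTensor (g : FormField I M) (A : EndField I M) (p : M)
    (x y z : TangentSpace I p) : ℝ :=
  g p (covDerivEnd (leviCivita g) A p x y) z

/-- The Lee form `θ(z) = g^{ij} F(e_i, e_j, z)`. -/
def leeForm (g : FormField I M) (A : EndField I M) (p : M) (z : TangentSpace I p) : ℝ :=
  metricTrace (g p) fun x y ↦ structureTensor g A p x y z

/-- The curvature tensor `R(x, y, z, w) = g(R(x, y) z, w)` of type `(0,4)` of the Levi-Civita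
connection. -/
def curvatureTensor (g : FormField I M) (p : M) (x y z w : TangentSpace I p) : ℝ :=
  g p (curvature (leviCivita g) p x y z) w

/-- The Ricci tensor `ρ(y, z) = g^{ij} R(e_i, y, z, e_j)`. -/
def ricci (g : FormField I M) (p : M) (y z : TangentSpace I p) : ℝ :=
  metricTrace (g p) fun x w ↦ curvatureTensor g p x y z w

/-- The associated Ricci tensor `ρ*(y, z) = g^{ij} R*(e_i, y, z, e_j)`, where
`R*(x, y, z, w) = R(x, y, z, A w)`. -/
def associatedRicci (g : FormField I M) (A : EndField I M) (p : M)
    (y z : TangentSpace I p) : ℝ :=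
  metricTrace (g p) fun x w ↦ curvatureTensor g p x y z (A p w)

end Manifold

section TangentBundle

variable {E : Type*} [NormedAddCommGroup E] [NormedSpace ℝ E]
  {H : Type*} [TopologicalSpace H] {I : ModelWithCorners ℝ E H}
  {M : Type*} [TopologicalSpace M] [ChartedSpace H M] [IsManifold I ∞ M]

/-! ### Almost Norden manifolds -/

variable (I M) in
/-- An almost Norden structure: a smooth pseudo-Riemannian metric `g` and a smooth almost complex
structure `J` that acts as an anti-isometry. That `g` is neutral and that the dimension is even
follows from this. -/
structure AlmostNordenStructure where
  /-- The metric. -/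
  g : FormField I M
  /-- The almost complex structure. -/
  J : EndField I M
  g_symm : ∀ p x y, g p x y = g p y x
  g_nondegenerate : ∀ p x, (∀ y, g p x y = 0) → x = 0
  g_smooth : ContMDiff I (I.prod 𝓘(ℝ, E →L[ℝ] E →L[ℝ] ℝ)) ∞
    fun p ↦ TotalSpace.mk' (E →L[ℝ] E →L[ℝ] ℝ)
      (E := fun p : M ↦ TangentSpace I p →L[ℝ] TangentSpace I p →L[ℝ] ℝ) p (g p)
  J_smooth : ContMDiff I (I.prod 𝓘(ℝ, E →L[ℝ] E)) ∞
    fun p ↦ TotalSpace.mk' (E →L[ℝ] E)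
      (E := fun p : M ↦ TangentSpace I p →L[ℝ] TangentSpace I p) p (J p)
  J_sq : ∀ p x, J p (J p x) = -x
  g_J : ∀ p x y, g p (J p x) (J p y) = -g p x y

/-! ### Lifts to the tangent bundle

The preferred chart of the tangent bundle at `u` is the one induced by the preferred chart `(x^i)`
of the base at the base point of `u`, with coordinates `(x^i, v^i)` for the vector `v^i ∂/∂x^i`. -/

/-- The vertical lift `x ↦ x^V` at `u`. In the induced chart, `x^V = x^k ∂/∂v^k`. -/
def verticalLift (u : TangentBundle I M) :
    TangentSpace I u.proj →L[ℝ] TangentSpace I.tangent u :=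
  (frame u u).comp ((ContinuousLinearMap.inr ℝ E E).comp (components u.proj u.proj))

/-- The horizontal lift `x ↦ x^H` at `u` with respect to a connection. In the induced chart,
`x^H = x^i ∂/∂x^i - Γ^k_{ij} x^i u^j ∂/∂v^k`. Here `Γ^k_{ij} x^i u^j` are the components of
`∇_x U`, where the vector field `U` has the constant components `u^j`. -/
def horizontalLift (cov : CovariantDerivative I E (TangentSpace I : M → Type _))
    (u : TangentBundle I M) : TangentSpace I u.proj →L[ℝ] TangentSpace I.tangent u :=
  letI U : Π q : M, TangentSpace I q := FiberBundle.extend E u.snd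
  (frame u u).comp
    ((components u.proj u.proj).prod (-((components u.proj u.proj).comp (cov U u.proj))))

variable [FiniteDimensional ℝ E]

theorem splitting_bijective (cov : CovariantDerivative I E (TangentSpace I : M → Type _))
    (u : TangentBundle I M) :
    Function.Bijective ((horizontalLift cov u).coprod (verticalLift u)) := by
  have hinj : Function.Injective ((horizontalLift cov u).coprod (verticalLift u)) := by
    rw [injective_iff_map_eq_zero]
    rintro ⟨x, y⟩ h
    have h' := congrArg (components u u) h
    simp only [ContinuousLinearMap.coprod_apply, horizontalLift, verticalLift,
      ContinuousLinearMap.comp_apply, map_add, components_frame, map_zero,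
      ContinuousLinearMap.prod_apply, ContinuousLinearMap.inr_apply, Prod.mk_add_mk, add_zero,
      Prod.mk_eq_zero] at h'
    have hx : x = 0 := by rw [← frame_components u.proj x, h'.1, map_zero]
    subst hx
    have hy := h'.2
    rw [map_zero, zero_add] at hy
    rw [← frame_components u.proj y, hy, map_zero]
    rfl
  refine ⟨hinj, ?_⟩
  have hd : Module.finrank ℝ (TangentSpace I u.proj × TangentSpace I u.proj) =
      Module.finrank ℝ (TangentSpace I.tangent u) :=
    show Module.finrank ℝ (E × E) = Module.finrank ℝ (E × E) from rfl
  exact (LinearMap.injective_iff_surjective_of_finrank_eq_finrank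
    (f := ((horizontalLift cov u).coprod (verticalLift u)).toLinearMap) hd).1 hinj

/-- The splitting `(x, y) ↦ x^H + y^V` of the tangent space at `u` of the tangent bundle into
horizontal and vertical vectors. -/
def splitting (cov : CovariantDerivative I E (TangentSpace I : M → Type _))
    (u : TangentBundle I M) :
    (TangentSpace I u.proj × TangentSpace I u.proj) ≃L[ℝ] TangentSpace I.tangent u :=
  (LinearEquiv.ofBijective _ (splitting_bijective cov u)).toContinuousLinearEquiv

/-- The base vector `x` in the decomposition `x^H + y^V` of a vector at `u`. -/
def horizontalPart (cov : CovariantDerivative I E (TangentSpace I : M → Type _))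
    (u : TangentBundle I M) : TangentSpace I.tangent u →L[ℝ] TangentSpace I u.proj :=
  (ContinuousLinearMap.fst ℝ _ _).comp (splitting cov u).symm.toContinuousLinearMap

/-- The base vector `y` in the decomposition `x^H + y^V` of a vector at `u`. -/
def verticalPart (cov : CovariantDerivative I E (TangentSpace I : M → Type _))
    (u : TangentBundle I M) : TangentSpace I.tangent u →L[ℝ] TangentSpace I u.proj :=
  (ContinuousLinearMap.snd ℝ _ _).comp (splitting cov u).symm.toContinuousLinearMap

theorem splitting_apply (cov : CovariantDerivative I E (TangentSpace I : M → Type _))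
    (u : TangentBundle I M) (x y : TangentSpace I u.proj) :
    splitting cov u (x, y) = horizontalLift cov u x + verticalLift u y := rfl

theorem splitting_symm_horizontalLift
    (cov : CovariantDerivative I E (TangentSpace I : M → Type _))
    (u : TangentBundle I M) (x : TangentSpace I u.proj) :
    (splitting cov u).symm (horizontalLift cov u x) = (x, 0) := by
  rw [ContinuousLinearEquiv.symm_apply_eq, splitting_apply, map_zero, add_zero]

theorem splitting_symm_verticalLift
    (cov : CovariantDerivative I E (TangentSpace I : M → Type _))
    (u : TangentBundle I M) (y : TangentSpace I u.proj) :
    (splitting cov u).symm (verticalLift u y) = (0, y) := by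
  rw [ContinuousLinearEquiv.symm_apply_eq, splitting_apply, map_zero, zero_add]

/-- The complete lift `ĝ` of a metric `g`, with `ĝ(x^H, y^H) = ĝ(x^V, y^V) = 0` and
`ĝ(x^H, y^V) = ĝ(x^V, y^H) = g(x, y)`. -/
def completeLift (g : FormField I M) : FormField I.tangent (TangentBundle I M) := fun u ↦
  letI h := horizontalPart (leviCivita g) u
  letI v := verticalPart (leviCivita g) u
  pullForm (g u.proj) h v + pullForm (g u.proj) v h

/-- `J₁ x^H = -(J x)^H` and `J₁ x^V = (J x)^V`. -/
def liftJ₁ (g : FormField I M) (J : EndField I M) : EndField I.tangent (TangentBundle I M) :=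
  fun u ↦
    -(horizontalLift (leviCivita g) u).comp ((J u.proj).comp (horizontalPart (leviCivita g) u)) +
      (verticalLift u).comp ((J u.proj).comp (verticalPart (leviCivita g) u))

/-- `J₂ x^H = x^V` and `J₂ x^V = -x^H`. -/
def liftJ₂ (g : FormField I M) : EndField I.tangent (TangentBundle I M) :=
  fun u ↦
    (verticalLift u).comp (horizontalPart (leviCivita g) u) -
      (horizontalLift (leviCivita g) u).comp (verticalPart (leviCivita g) u)

/-- `J₃ x^H = (J x)^V` and `J₃ x^V = (J x)^H`. -/
def liftJ₃ (g : FormField I M) (J : EndField I M) : EndField I.tangent (TangentBundle I M) :=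
  fun u ↦
    (verticalLift u).comp ((J u.proj).comp (horizontalPart (leviCivita g) u)) +
      (horizontalLift (leviCivita g) u).comp ((J u.proj).comp (verticalPart (leviCivita g) u))

end TangentBundle

end AlmostNorden

end

/-! Everything is computed in the induced coordinates `(x, v)` of the tangent bundle. There the
complete lift is `G(a₁, b₂) + G(a₂, b₁) + (∂_v G)(a₁, b₁)`, and differentiating the identity that
defines the Christoffel symbols `Γ` of `G` gives those of the lift: `Γ` in the first slot, and `∂_v
Γ(a₁, b₁) + Γ(a₁, b₂) + Γ(a₂, b₁)` in the second (`christoffel_chartLift`). Hence, for a vector `ξ`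
at `u` over the base vector `x`, `∇̂_ξ Y^V = (∇_x Y)^V` and `∇̂_ξ Y^H = (∇_x Y)^H + (R(u, x)Y)^V`
(`nabla_vertical`, `nabla_horizontal`). In particular lifts are parallel along the fibres.

The lifted metric pairs horizontal with vertical vectors by `g`, so a trace on the tangent bundle is
the sum of two traces on the base, over the pairs `(e_i^H, e_j^V)` and `(e_i^V, e_j^H)`
(`metricTrace_prod`). The second vanishes for all three structures because the differentiation is
vertical. In the first, `(∇̂_{a^H} J_α) b^V` equals `((∇_a J) b)^V`, `-(R(u, a)b)^V` and `((∇_a J)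
b)^H + (R(u, a)Jb)^V` respectively. With the skew symmetries of the curvature this yields, for `ζ =
x^H + y^V` at `u`, `θ₁(ζ) = θ(x)`, `θ₂(ζ) = -ρ(u, x)` and `θ₃(ζ) = θ(y) + ρ*(u, x)`
(`leeForm_liftJ₁`, `leeForm_liftJ₂`, `leeForm_liftJ₃`). Since `u`, `x`, `y` are arbitrary, the
equivalences follow.

The remaining work is the passage to coordinates. The connection is defined at each point through
the preferred chart of that point, whereas curvature and horizontal lifts require it in one chart on
a whole neighbourhood. The transformation law of the Christoffel symbols supplies this
(`components_leviCivita`, `components_horizontalLift`). -/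

noncomputable section

namespace AlmostNorden

section Coordinates

variable {F : Type*} [NormedAddCommGroup F] [NormedSpace ℝ F]

/-! ### Metrics on open sets of a vector space -/

/-- The linear map that sends `D` to `(a, b, c) ↦ D b a c`. -/
def swapFirst : (F →L[ℝ] F →L[ℝ] F →L[ℝ] ℝ) →L[ℝ] (F →L[ℝ] F →L[ℝ] F →L[ℝ] ℝ) :=
  (ContinuousLinearMap.flipₗᵢ ℝ F F (F →L[ℝ] ℝ)).toContinuousLinearEquiv.toContinuousLinearMap

/-- The linear map that sends `B` to `(a, b) ↦ B b a`. -/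
def swapForm : (F →L[ℝ] F →L[ℝ] ℝ) →L[ℝ] (F →L[ℝ] F →L[ℝ] ℝ) :=
  (ContinuousLinearMap.flipₗᵢ ℝ F F ℝ).toContinuousLinearEquiv.toContinuousLinearMap

set_option synthInstance.maxHeartbeats 400000 in
/-- The linear map that sends `D` to `(a, b, c) ↦ D c a b`. -/
def rotateForm : (F →L[ℝ] F →L[ℝ] F →L[ℝ] ℝ) →L[ℝ] (F →L[ℝ] F →L[ℝ] F →L[ℝ] ℝ) :=
  (ContinuousLinearMap.compL ℝ F (F →L[ℝ] F →L[ℝ] ℝ) (F →L[ℝ] F →L[ℝ] ℝ) swapForm).comp swapFirst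

set_option synthInstance.maxHeartbeats 400000 in
/-- The linear map that sends `D` to `(a, b, c) ↦ (D a b c + D b a c - D c a b) / 2`. -/
def koszulMap : (F →L[ℝ] F →L[ℝ] F →L[ℝ] ℝ) →L[ℝ] (F →L[ℝ] F →L[ℝ] F →L[ℝ] ℝ) :=
  (2⁻¹ : ℝ) • (ContinuousLinearMap.id ℝ _ + swapFirst - rotateForm)

theorem koszulMap_apply (D : F →L[ℝ] F →L[ℝ] F →L[ℝ] ℝ) (a b c : F) :
    koszulMap D a b c = 2⁻¹ * (D a b c + D b a c - D c a b) :=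
  rfl

/-- The Christoffel symbols of a field `G` of bilinear forms on a vector space. -/
def chartChristoffel (G : F → F →L[ℝ] F →L[ℝ] ℝ) (y : F) : F →L[ℝ] F →L[ℝ] F :=
  (ContinuousLinearMap.compL ℝ F (F →L[ℝ] ℝ) F (G y).inverse).comp (koszulMap (fderiv ℝ G y))

/-- The covariant derivative of the vector field `s` in the direction `a`. -/
def chartNabla (G : F → F →L[ℝ] F →L[ℝ] ℝ) (s : F → F) (y a : F) : F :=
  fderiv ℝ s y a + chartChristoffel G y (s y) a

/-- The covariant derivative `(∇_a A) b` of a field `A` of endomorphisms. -/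
def chartNablaEnd (G : F → F →L[ℝ] F →L[ℝ] ℝ) (A : F → F →L[ℝ] F) (y : F) :
    F →L[ℝ] F →L[ℝ] F :=
  fderiv ℝ A y + ((chartChristoffel G y).comp (A y)).flip -
    (ContinuousLinearMap.compL ℝ F F F (A y)).comp (chartChristoffel G y).flip

theorem chartNablaEnd_apply (G : F → F →L[ℝ] F →L[ℝ] ℝ) (A : F → F →L[ℝ] F) (y a b : F) :
    chartNablaEnd G A y a b = fderiv ℝ A y a b + chartChristoffel G y (A y b) a -
      A y (chartChristoffel G y b a) := by
  simp [chartNablaEnd]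

/-- The curvature `R(a, b) c` in coordinates. -/
def chartCurvature (G : F → F →L[ℝ] F →L[ℝ] ℝ) (y a b c : F) : F :=
  fderiv ℝ (chartChristoffel G) y a c b + chartChristoffel G y (chartChristoffel G y c b) a -
    (fderiv ℝ (chartChristoffel G) y b c a +
      chartChristoffel G y (chartChristoffel G y c a) b)

theorem hasFDerivAt_apply_const {V W : Type*} [NormedAddCommGroup V] [NormedSpace ℝ V]
    [NormedAddCommGroup W] [NormedSpace ℝ W] {f : F → V →L[ℝ] W} {y : F}
    (hf : DifferentiableAt ℝ f y) (v : V) :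
    HasFDerivAt (fun z ↦ f z v) ((fderiv ℝ f y).flip v) y :=
  (ContinuousLinearMap.apply ℝ W v).hasFDerivAt.comp y hf.hasFDerivAt

theorem hasFDerivAt_apply_const₂ {V V' W : Type*} [NormedAddCommGroup V] [NormedSpace ℝ V]
    [NormedAddCommGroup V'] [NormedSpace ℝ V'] [NormedAddCommGroup W] [NormedSpace ℝ W]
    {f : F → V →L[ℝ] V' →L[ℝ] W} {y : F} (hf : DifferentiableAt ℝ f y) (v : V) (w : V') :
    HasFDerivAt (fun z ↦ f z v w) (((fderiv ℝ f y).flip v).flip w) y := by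
  have h := hasFDerivAt_apply_const hf v
  have h' := hasFDerivAt_apply_const h.differentiableAt w
  rwa [h.fderiv] at h'

theorem chartCurvature_swap (G : F → F →L[ℝ] F →L[ℝ] ℝ) (y a b c : F) :
    chartCurvature G y b a c = -chartCurvature G y a b c := by
  simp only [chartCurvature]
  abel

/-- `G` is a smooth pseudo-Riemannian metric on the open set `U` of a vector space. -/
structure IsMetricOn (G : F → F →L[ℝ] F →L[ℝ] ℝ) (U : Set F) : Prop where
  isOpen : IsOpen U
  contDiffOn : ContDiffOn ℝ ∞ G U
  symm : ∀ y ∈ U, ∀ a b, G y a b = G y b a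
  nondegenerate : ∀ y ∈ U, ∀ a, (∀ b, G y a b = 0) → a = 0

/-- The Leibniz rule. It allows `∇A` to be computed with any differentiable extension of the
argument; on the tangent bundle the convenient one is a horizontal field, whose components are not
constant. -/
theorem chartNablaEnd_field {G : F → F →L[ℝ] F →L[ℝ] ℝ} {A : F → F →L[ℝ] F} {N : F → F} {y : F}
    (hA : DifferentiableAt ℝ A y) (hN : DifferentiableAt ℝ N y) (a : F) :
    chartNablaEnd G A y a (N y) =
      chartNabla G (fun y' ↦ A y' (N y')) y a - A y (chartNabla G N y a) := by
  simp only [chartNablaEnd_apply, chartNabla, fderiv_clm_apply hA hN, _root_.add_apply,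
    ContinuousLinearMap.comp_apply, ContinuousLinearMap.flip_apply, map_add]
  abel

theorem chartNabla_zero (G : F → F →L[ℝ] F →L[ℝ] ℝ) (s : F → F) (y : F) :
    chartNabla G s y 0 = 0 := by
  simp [chartNabla]

/-! ### Levi-Civita calculus in coordinates: compatibility, symmetry, curvature -/

namespace IsMetricOn

variable {G : F → F →L[ℝ] F →L[ℝ] ℝ} {U : Set F} {y : F}

theorem contDiffAt (h : IsMetricOn G U) (hy : y ∈ U) : ContDiffAt ℝ ∞ G y :=
  h.contDiffOn.contDiffAt (h.isOpen.mem_nhds hy)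

theorem differentiableAt (h : IsMetricOn G U) (hy : y ∈ U) : DifferentiableAt ℝ G y :=
  (h.contDiffAt hy).differentiableAt (by simp)

theorem contDiffAt_fderiv (h : IsMetricOn G U) (hy : y ∈ U) : ContDiffAt ℝ ∞ (fderiv ℝ G) y :=
  (h.contDiffAt hy).fderiv_right (by simp)

theorem fderiv_symm (h : IsMetricOn G U) (hy : y ∈ U) (a b c : F) :
    fderiv ℝ G y a b c = fderiv ℝ G y a c b := by
  have hG := h.differentiableAt hy
  have key : (fun z ↦ G z b c) =ᶠ[nhds y] fun z ↦ G z c b := by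
    filter_upwards [h.isOpen.mem_nhds hy] with z hz using h.symm z hz b c
  have e : ∀ b c, fderiv ℝ (fun z ↦ G z b c) y a = fderiv ℝ G y a b c := fun b c ↦ by
    rw [(hasFDerivAt_apply_const₂ hG b c).fderiv]
    rfl
  rw [← e, ← e, key.fderiv_eq]

theorem eq_of_forall (h : IsMetricOn G U) (hy : y ∈ U) {a b : F}
    (hab : ∀ c, G y a c = G y b c) : a = b :=
  sub_eq_zero.1 (h.nondegenerate y hy _ fun c ↦ by simp [hab c])

theorem fderiv_fderiv_symm (h : IsMetricOn G U) (hy : y ∈ U) (a b : F) :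
    fderiv ℝ (fderiv ℝ G) y a b = fderiv ℝ (fderiv ℝ G) y b a :=
  ((h.contDiffAt hy).isSymmSndFDerivAt (by
    simp only [minSmoothness_of_isRCLikeNormedField]
    exact WithTop.coe_le_coe.2 le_top)).eq a b

variable [FiniteDimensional ℝ F]

theorem _root_.AlmostNorden.isInvertible_of_nondegenerate {B : F →L[ℝ] F →L[ℝ] ℝ}
    (h : ∀ a, (∀ b, B a b = 0) → a = 0) : B.IsInvertible := by
  have hd : Module.finrank ℝ F = Module.finrank ℝ (F →L[ℝ] ℝ) := by
    rw [← (LinearMap.toContinuousLinearMap (𝕜 := ℝ) (E := F) (F' := ℝ)).finrank_eq]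
    exact (Subspace.dual_finrank_eq (K := ℝ) (V := F)).symm
  have hi : Function.Injective B.toLinearMap := by
    rw [injective_iff_map_eq_zero]
    intro a ha
    exact h a fun b ↦ by rw [show B a = 0 from ha]; rfl
  have hs := (LinearMap.injective_iff_surjective_of_finrank_eq_finrank hd).1 hi
  exact ⟨(LinearEquiv.ofBijective B.toLinearMap ⟨hi, hs⟩).toContinuousLinearEquiv, rfl⟩

/-- `ContinuousLinearMap.inverse` takes a default value on non-invertible maps; on `U` this makes
the inverse in `chartChristoffel` a genuine one. -/
theorem isInvertible (h : IsMetricOn G U) (hy : y ∈ U) : (G y).IsInvertible :=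
  isInvertible_of_nondegenerate (h.nondegenerate y hy)

/-- Lowering the index removes the inverse metric; identities for `Γ` are then proved by pairing
both sides with a test vector. -/
theorem christoffel_spec (h : IsMetricOn G U) (hy : y ∈ U) (a b c : F) :
    G y (chartChristoffel G y a b) c = koszulMap (fderiv ℝ G y) a b c := by
  obtain ⟨e, he⟩ := h.isInvertible hy
  have : G y (chartChristoffel G y a b) = koszulMap (fderiv ℝ G y) a b := by
    simp only [chartChristoffel, ContinuousLinearMap.comp_apply, ContinuousLinearMap.compL_apply]
    rw [← he, ContinuousLinearMap.inverse_equiv]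
    simp
  rw [this]

theorem christoffel_symm (h : IsMetricOn G U) (hy : y ∈ U) (a b : F) :
    chartChristoffel G y a b = chartChristoffel G y b a := by
  refine h.eq_of_forall hy fun c ↦ ?_
  simp only [h.christoffel_spec hy, koszulMap_apply, h.fderiv_symm hy c a b]
  ring

/-- Compatibility `∇g = 0`: in the sum of the two Koszul expressions all terms but `∂_a G(b, c)`
cancel. -/
theorem fderiv_eq_christoffel (h : IsMetricOn G U) (hy : y ∈ U) (a b c : F) :
    fderiv ℝ G y a b c =
      G y (chartChristoffel G y a b) c + G y b (chartChristoffel G y a c) := by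
  rw [h.symm y hy b]
  simp only [h.christoffel_spec hy, koszulMap_apply]
  linarith [h.fderiv_symm hy a c b, h.fderiv_symm hy b c a, h.fderiv_symm hy c b a]

theorem contDiffAt_christoffel (h : IsMetricOn G U) (hy : y ∈ U) :
    ContDiffAt ℝ ∞ (chartChristoffel G) y := by
  have : CompleteSpace F := FiniteDimensional.complete ℝ F
  have h1 : ContDiffAt ℝ ∞ (fun z ↦ (G z).inverse) y := by
    obtain ⟨e, he⟩ := h.isInvertible hy
    have h2 : ContDiffAt ℝ ∞ ContinuousLinearMap.inverse (G y) := by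
      rw [← he]
      exact contDiffAt_map_inverse e
    exact h2.comp y (h.contDiffAt hy)
  have h3 : ContDiffAt ℝ ∞ (fun z ↦ koszulMap (fderiv ℝ G z)) y :=
    koszulMap.contDiff.contDiffAt.comp y (h.contDiffAt_fderiv hy)
  exact ((ContinuousLinearMap.compL ℝ F (F →L[ℝ] ℝ) F).contDiff.contDiffAt.comp y h1).clm_comp h3

theorem differentiableAt_christoffel (h : IsMetricOn G U) (hy : y ∈ U) :
    DifferentiableAt ℝ (chartChristoffel G) y :=
  (h.contDiffAt_christoffel hy).differentiableAt (by simp)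

theorem fderiv_fderiv_eq_christoffel (h : IsMetricOn G U) (hy : y ∈ U) (a b c d : F) :
    fderiv ℝ (fderiv ℝ G) y b a c d =
      fderiv ℝ G y b (chartChristoffel G y a c) d + G y (fderiv ℝ (chartChristoffel G) y b a c) d +
      (fderiv ℝ G y b c (chartChristoffel G y a d) +
        G y c (fderiv ℝ (chartChristoffel G) y b a d)) := by
  have hΓ := h.differentiableAt_christoffel hy
  have hG := h.differentiableAt hy
  have hG' : DifferentiableAt ℝ (fderiv ℝ G) y := (h.contDiffAt_fderiv hy).differentiableAt (by simp)
  have key : (fun z ↦ fderiv ℝ G z a c d) =ᶠ[nhds y] fun z ↦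
      G z (chartChristoffel G z a c) d + G z c (chartChristoffel G z a d) := by
    filter_upwards [h.isOpen.mem_nhds hy] with z hz using h.fderiv_eq_christoffel hz a c d
  have e1 := hasFDerivAt_apply_const₂ (hasFDerivAt_apply_const hG' a).differentiableAt c d
  rw [(hasFDerivAt_apply_const hG' a).fderiv] at e1
  have h1 := hG.hasFDerivAt.clm_apply (hasFDerivAt_apply_const₂ hΓ a c)
  have e2 := hasFDerivAt_apply_const h1.differentiableAt d
  rw [h1.fderiv] at e2
  have e3 := (hasFDerivAt_apply_const hG c).clm_apply (hasFDerivAt_apply_const₂ hΓ a d)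
  have e := DFunLike.congr_fun (e1.unique ((e2.add e3).congr_of_eventuallyEq key)) b
  simp only [_root_.add_apply, ContinuousLinearMap.comp_apply,
    ContinuousLinearMap.flip_apply] at e
  linarith

theorem fderiv_christoffel_symm (h : IsMetricOn G U) (hy : y ∈ U) (a b c : F) :
    fderiv ℝ (chartChristoffel G) y a b c = fderiv ℝ (chartChristoffel G) y a c b := by
  have hΓ := h.differentiableAt_christoffel hy
  have key : (fun z ↦ chartChristoffel G z b c) =ᶠ[nhds y] fun z ↦ chartChristoffel G z c b := by
    filter_upwards [h.isOpen.mem_nhds hy] with z hz using h.christoffel_symm hz b c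
  exact DFunLike.congr_fun ((hasFDerivAt_apply_const₂ hΓ b c).unique
    ((hasFDerivAt_apply_const₂ hΓ c b).congr_of_eventuallyEq key)) a

/-- The curvature tensor is skew-symmetric in its last two arguments. -/
theorem curvature_skew (h : IsMetricOn G U) (hy : y ∈ U) (a b c d : F) :
    G y (chartCurvature G y a b c) d = -G y (chartCurvature G y a b d) c := by
  have e1 := h.fderiv_fderiv_eq_christoffel hy a b c d
  have e2 := h.fderiv_fderiv_eq_christoffel hy b a c d
  -- Second derivatives of `G` commute, so `e1` and `e2` now have the same left side. Comparing the
  -- right sides is the Ricci identity for `g`; the rest only brings the `Γ` terms to a common form.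
  rw [h.fderiv_fderiv_symm hy b a] at e1
  simp only [h.fderiv_eq_christoffel hy] at e1 e2
  simp only [chartCurvature, map_add, map_sub, _root_.add_apply, _root_.sub_apply]
  rw [h.fderiv_christoffel_symm hy a c b, h.fderiv_christoffel_symm hy b c a,
    h.fderiv_christoffel_symm hy a d b, h.fderiv_christoffel_symm hy b d a,
    h.christoffel_symm hy c b, h.christoffel_symm hy c a, h.christoffel_symm hy d b,
    h.christoffel_symm hy d a, h.christoffel_symm hy _ a, h.christoffel_symm hy (_ : F) b]
  rw [h.christoffel_symm hy (chartChristoffel G y b d) a,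
    h.christoffel_symm hy (chartChristoffel G y a d) b]
  simp only [h.symm y hy _ c]
  linarith

end IsMetricOn

end Coordinates

section CoordinateChange

variable {F : Type*} [NormedAddCommGroup F] [NormedSpace ℝ F] [FiniteDimensional ℝ F]
  {G G' : F → F →L[ℝ] F →L[ℝ] ℝ} {U U' : Set F} {τ : F → F} {y : F}

/-! ### Changes of coordinates -/

/-- The transformation law of the Christoffel symbols. -/
theorem IsMetricOn.fderiv_christoffel (h : IsMetricOn G U) (h' : IsMetricOn G' U') (hy : y ∈ U)
    (hy' : τ y ∈ U') (hτ : ContDiffAt ℝ 2 τ y) (hsurj : Function.Surjective (fderiv ℝ τ y))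
    (hG : ∀ᶠ z in nhds y, ∀ a b, G z a b = G' (τ z) (fderiv ℝ τ z a) (fderiv ℝ τ z b)) (a b : F) :
    fderiv ℝ τ y (chartChristoffel G y a b) =
      chartChristoffel G' (τ y) (fderiv ℝ τ y a) (fderiv ℝ τ y b) +
        fderiv ℝ (fderiv ℝ τ) y a b := by
  have hτ1 : DifferentiableAt ℝ τ y := hτ.differentiableAt (by simp)
  have hτ2 : DifferentiableAt ℝ (fderiv ℝ τ) y :=
    (hτ.fderiv_right (m := 1) (by norm_num [one_add_one_eq_two])).differentiableAt (by simp)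
  have hsymm : ∀ a b, fderiv ℝ (fderiv ℝ τ) y a b = fderiv ℝ (fderiv ℝ τ) y b a :=
    fun a b ↦ (hτ.isSymmSndFDerivAt (by simp)).eq a b
  -- In the Koszul combination of these derivatives the `D²τ` terms cancel in pairs, except for
  -- `G'(D²τ(a, b), Dτ c)`, which is the inhomogeneous term of the law.
  have hD : ∀ c a b, fderiv ℝ G y c a b =
      fderiv ℝ G' (τ y) (fderiv ℝ τ y c) (fderiv ℝ τ y a) (fderiv ℝ τ y b) +
        G' (τ y) (fderiv ℝ (fderiv ℝ τ) y c a) (fderiv ℝ τ y b) +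
        G' (τ y) (fderiv ℝ τ y a) (fderiv ℝ (fderiv ℝ τ) y c b) := by
    intro c a b
    have e1 := hasFDerivAt_apply_const₂ (h.differentiableAt hy) a b
    have hG' : HasFDerivAt (fun z ↦ G' (τ z)) ((fderiv ℝ G' (τ y)).comp (fderiv ℝ τ y)) y :=
      (h'.differentiableAt hy').hasFDerivAt.comp y hτ1.hasFDerivAt
    have e2 := (hG'.clm_apply (hasFDerivAt_apply_const hτ2 a)).clm_apply
      (hasFDerivAt_apply_const hτ2 b)
    have e := DFunLike.congr_fun (e1.unique (e2.congr_of_eventuallyEq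
      (hG.mono fun z hz ↦ hz a b))) c
    simp only [_root_.add_apply, ContinuousLinearMap.comp_apply,
      ContinuousLinearMap.flip_apply] at e
    linarith
  -- Surjectivity of `Dτ` lets every test vector be written as `Dτ c`, so both sides can be read off
  -- from the Koszul formulas.
  refine h'.eq_of_forall hy' fun c' ↦ ?_
  obtain ⟨c, rfl⟩ := hsurj c'
  rw [← hG.self_of_nhds, h.christoffel_spec hy, map_add, _root_.add_apply,
    h'.christoffel_spec hy', koszulMap_apply, koszulMap_apply, hD, hD, hD, hsymm b a, hsymm c a,
    hsymm c b, h'.symm _ hy' (fderiv ℝ τ y b), h'.symm _ hy' (fderiv ℝ τ y a)]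
  ring

/-- The covariant derivative does not depend on the coordinates. -/
theorem IsMetricOn.fderiv_nabla (h : IsMetricOn G U) (h' : IsMetricOn G' U') (hy : y ∈ U)
    (hy' : τ y ∈ U') (hτ : ContDiffAt ℝ 2 τ y) (hsurj : Function.Surjective (fderiv ℝ τ y))
    (hG : ∀ᶠ z in nhds y, ∀ a b, G z a b = G' (τ z) (fderiv ℝ τ z a) (fderiv ℝ τ z b))
    {s s' : F → F} (hs : DifferentiableAt ℝ s y) (hs' : DifferentiableAt ℝ s' (τ y))
    (hss' : ∀ᶠ z in nhds y, s' (τ z) = fderiv ℝ τ z (s z)) (a : F) :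
    chartNabla G' s' (τ y) (fderiv ℝ τ y a) = fderiv ℝ τ y (chartNabla G s y a) := by
  have hτ1 : DifferentiableAt ℝ τ y := hτ.differentiableAt (by simp)
  have hτ2 : DifferentiableAt ℝ (fderiv ℝ τ) y :=
    (hτ.fderiv_right (m := 1) (by norm_num [one_add_one_eq_two])).differentiableAt (by simp)
  -- Differentiating `s'(τ z) = Dτ_z (s z)` produces a term `D²τ(a, s)`, which cancels the
  -- inhomogeneous term in the law for `Γ`.
  have e1 : HasFDerivAt (fun z ↦ s' (τ z)) ((fderiv ℝ s' (τ y)).comp (fderiv ℝ τ y)) y :=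
    hs'.hasFDerivAt.comp y hτ1.hasFDerivAt
  have e := DFunLike.congr_fun (e1.unique
    ((hτ2.hasFDerivAt.clm_apply hs.hasFDerivAt).congr_of_eventuallyEq hss')) a
  simp only [_root_.add_apply, ContinuousLinearMap.comp_apply,
    ContinuousLinearMap.flip_apply] at e
  have hsymm : fderiv ℝ (fderiv ℝ τ) y a (s y) = fderiv ℝ (fderiv ℝ τ) y (s y) a :=
    (hτ.isSymmSndFDerivAt (by simp)).eq a (s y)
  rw [chartNabla, chartNabla, e, map_add, h.fderiv_christoffel h' hy hy' hτ hsurj hG,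
    hss'.self_of_nhds, hsymm]
  abel

end CoordinateChange

section Lift

variable {F : Type*} [NormedAddCommGroup F] [NormedSpace ℝ F]

/-! ### Complete lifts in coordinates -/

/-- The complete lift of a metric in the coordinates `(x, v)`. -/
def chartLift (G : F → F →L[ℝ] F →L[ℝ] ℝ) (w : F × F) : F × F →L[ℝ] F × F →L[ℝ] ℝ :=
  pullForm (G w.1) (.fst ℝ F F) (.snd ℝ F F) + pullForm (G w.1) (.snd ℝ F F) (.fst ℝ F F) +
    pullForm (fderiv ℝ G w.1 w.2) (.fst ℝ F F) (.fst ℝ F F)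

@[simp]
theorem chartLift_apply (G : F → F →L[ℝ] F →L[ℝ] ℝ) (w a b : F × F) :
    chartLift G w a b = G w.1 a.1 b.2 + G w.1 a.2 b.1 + fderiv ℝ G w.1 w.2 a.1 b.1 := rfl

theorem chartLift_vertical (G : F → F →L[ℝ] F →L[ℝ] ℝ) (w : F × F) (a : F)
    (c : F × F) : chartLift G w (0, a) c = G w.1 a c.1 := by
  simp

/-- The horizontal lift in coordinates. -/
def chartHor (G : F → F →L[ℝ] F →L[ℝ] ℝ) (w : F × F) : F →L[ℝ] F × F :=
  .inl ℝ F F - (ContinuousLinearMap.inr ℝ F F).comp (chartChristoffel G w.1 w.2)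

@[simp]
theorem chartHor_apply (G : F → F →L[ℝ] F →L[ℝ] ℝ) (w : F × F) (a : F) :
    chartHor G w a = (a, -chartChristoffel G w.1 w.2 a) := by
  simp [chartHor]

/-- The vertical part of a vector in coordinates. -/
def chartVertPart (G : F → F →L[ℝ] F →L[ℝ] ℝ) (w : F × F) : F × F →L[ℝ] F :=
  .snd ℝ F F + (chartChristoffel G w.1 w.2).comp (.fst ℝ F F)

@[simp]
theorem chartVertPart_apply (G : F → F →L[ℝ] F →L[ℝ] ℝ) (w a : F × F) :
    chartVertPart G w a = a.2 + chartChristoffel G w.1 w.2 a.1 := rfl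

/-- The field of endomorphisms `x^H ↦ -(A x)^H`, `x^V ↦ (A x)^V` in coordinates. -/
def chartLift₁ (G : F → F →L[ℝ] F →L[ℝ] ℝ) (A : F → F →L[ℝ] F) (w : F × F) :
    F × F →L[ℝ] F × F :=
  -(chartHor G w).comp ((A w.1).comp (.fst ℝ F F)) +
    (ContinuousLinearMap.inr ℝ F F).comp ((A w.1).comp (chartVertPart G w))

/-- The field of endomorphisms `x^H ↦ x^V`, `x^V ↦ -x^H` in coordinates. -/
def chartLift₂ (G : F → F →L[ℝ] F →L[ℝ] ℝ) (w : F × F) : F × F →L[ℝ] F × F :=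
  (ContinuousLinearMap.inr ℝ F F).comp (.fst ℝ F F) - (chartHor G w).comp (chartVertPart G w)

/-- The field of endomorphisms `x^H ↦ (A x)^V`, `x^V ↦ (A x)^H` in coordinates. -/
def chartLift₃ (G : F → F →L[ℝ] F →L[ℝ] ℝ) (A : F → F →L[ℝ] F) (w : F × F) :
    F × F →L[ℝ] F × F :=
  (ContinuousLinearMap.inr ℝ F F).comp ((A w.1).comp (.fst ℝ F F)) +
    (chartHor G w).comp ((A w.1).comp (chartVertPart G w))

/-! ### The Levi-Civita connection of the complete lift -/

namespace IsMetricOn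

variable {G : F → F →L[ℝ] F →L[ℝ] ℝ} {U : Set F}

theorem hasFDerivAt_chartLift_apply (h : IsMetricOn G U) {w : F × F} (hw : w.1 ∈ U) (a b : F × F) :
    HasFDerivAt (fun z ↦ chartLift G z a b)
      ((((fderiv ℝ G w.1).flip a.1).flip b.2).comp (.fst ℝ F F) +
        (((fderiv ℝ G w.1).flip a.2).flip b.1).comp (.fst ℝ F F) +
        (((((fderiv ℝ (fderiv ℝ G) w.1).flip w.2).flip a.1).flip b.1).comp (.fst ℝ F F) +
          (((fderiv ℝ G w.1).flip a.1).flip b.1).comp (.snd ℝ F F))) w := by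
  have hG := h.differentiableAt hw
  have hG' : DifferentiableAt ℝ (fderiv ℝ G) w.1 :=
    (h.contDiffAt_fderiv hw).differentiableAt (by simp)
  have e1 : ∀ a b, HasFDerivAt (fun z : F × F ↦ G z.1 a b)
      ((((fderiv ℝ G w.1).flip a).flip b).comp (.fst ℝ F F)) w := fun a b ↦
    (hasFDerivAt_apply_const₂ hG a b).comp w hasFDerivAt_fst
  have e2 : HasFDerivAt (fun z : F × F ↦ fderiv ℝ G z.1)
      ((fderiv ℝ (fderiv ℝ G) w.1).comp (.fst ℝ F F)) w :=
    hG'.hasFDerivAt.comp w hasFDerivAt_fst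
  have e3 := e2.clm_apply (hasFDerivAt_snd (p := w))
  have e4 := hasFDerivAt_apply_const₂ e3.differentiableAt a.1 b.1
  rw [e3.fderiv] at e4
  refine (((e1 a.1 b.2).add (e1 a.2 b.1)).add e4).congr_fderiv ?_
  ext c <;> simp

/-- Vertical test vectors detect `a.1`; once that is zero, the vectors `(b, 0)` detect `a.2`. The
calculus for metrics on open sets thus applies to the lift itself. -/
theorem chartLift (h : IsMetricOn G U) : IsMetricOn (chartLift G) (U ×ˢ Set.univ) where
  isOpen := h.isOpen.prod isOpen_univ
  contDiffOn := by
    intro w hw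
    refine ContDiffAt.contDiffWithinAt ?_
    have h1 : ContDiffAt ℝ ∞ (fun z : F × F ↦ G z.1) w :=
      (h.contDiffAt hw.1).comp w contDiffAt_fst
    have h2 : ContDiffAt ℝ ∞ (fun z : F × F ↦ fderiv ℝ G z.1 z.2) w :=
      ((h.contDiffAt_fderiv hw.1).comp w contDiffAt_fst).clm_apply contDiffAt_snd
    have h3 : ∀ {B : F × F → F →L[ℝ] F →L[ℝ] ℝ} (a b : F × F →L[ℝ] F), ContDiffAt ℝ ∞ B w →
        ContDiffAt ℝ ∞ (fun z ↦ pullForm (B z) a b) w := fun a b hB ↦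
      contDiffAt_const.clm_comp (hB.clm_comp contDiffAt_const)
    exact ((h3 _ _ h1).add (h3 _ _ h1)).add (h3 _ _ h2)
  symm w hw a b := by
    rw [chartLift_apply, chartLift_apply, h.symm _ hw.1 a.1, h.symm _ hw.1 a.2,
      h.fderiv_symm hw.1 w.2]
    ring
  nondegenerate w hw a ha := by
    have h1 : a.1 = 0 := h.nondegenerate _ hw.1 _ fun b ↦ by simpa using ha (0, b)
    have h2 : a.2 = 0 := h.nondegenerate _ hw.1 _ fun b ↦ by simpa [h1] using ha (b, 0)
    exact Prod.ext h1 h2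

variable [FiniteDimensional ℝ F]

/-- The derivative along `v` of the defining identity of `Γ`, using that `koszulMap` is linear and
constant. It evaluates the second-order part of the Koszul formula of the lift. -/
theorem koszulMap_fderiv_fderiv (h : IsMetricOn G U) {y : F} (hy : y ∈ U) (v a b c : F) :
    koszulMap (fderiv ℝ (fderiv ℝ G) y v) a b c =
      fderiv ℝ G y v (chartChristoffel G y a b) c +
        G y (fderiv ℝ (chartChristoffel G) y v a b) c := by
  have hΓ := h.differentiableAt_christoffel hy
  have hG := h.differentiableAt hy
  have hG' : DifferentiableAt ℝ (fderiv ℝ G) y := (h.contDiffAt_fderiv hy).differentiableAt (by simp)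
  have key : (fun z ↦ koszulMap (fderiv ℝ G z) a b c) =ᶠ[nhds y] fun z ↦
      G z (chartChristoffel G z a b) c := by
    filter_upwards [h.isOpen.mem_nhds hy] with z hz using (h.christoffel_spec hz a b c).symm
  have h0 : HasFDerivAt (fun z ↦ koszulMap (fderiv ℝ G z))
      (koszulMap.comp (fderiv ℝ (fderiv ℝ G) y)) y :=
    koszulMap.hasFDerivAt.comp y hG'.hasFDerivAt
  have e1 := hasFDerivAt_apply_const (hasFDerivAt_apply_const₂ h0.differentiableAt a b).differentiableAt c
  rw [(hasFDerivAt_apply_const₂ h0.differentiableAt a b).fderiv, h0.fderiv] at e1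
  have h1 := hG.hasFDerivAt.clm_apply (hasFDerivAt_apply_const₂ hΓ a b)
  have e2 := hasFDerivAt_apply_const h1.differentiableAt c
  rw [h1.fderiv] at e2
  have e := DFunLike.congr_fun (e1.unique (e2.congr_of_eventuallyEq key)) v
  simp only [_root_.add_apply, ContinuousLinearMap.comp_apply,
    ContinuousLinearMap.flip_apply] at e
  linarith

theorem christoffel_chartLift (h : IsMetricOn G U) {w : F × F} (hw : w.1 ∈ U) (a b : F × F) :
    chartChristoffel (AlmostNorden.chartLift G) w a b =
      (chartChristoffel G w.1 a.1 b.1, fderiv ℝ (chartChristoffel G) w.1 w.2 a.1 b.1 +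
        chartChristoffel G w.1 a.1 b.2 + chartChristoffel G w.1 a.2 b.1) := by
  have hw' : w ∈ U ×ˢ (Set.univ : Set F) := ⟨hw, trivial⟩
  refine h.chartLift.eq_of_forall hw' fun c ↦ ?_
  have hd : ∀ c a b, fderiv ℝ (AlmostNorden.chartLift G) w c a b = _ := fun c a b ↦
    DFunLike.congr_fun ((hasFDerivAt_apply_const₂ (h.chartLift.differentiableAt hw') a b).unique
      (h.hasFDerivAt_chartLift_apply hw a b)) c
  rw [h.chartLift.christoffel_spec hw', koszulMap_apply, hd, hd, hd, chartLift_apply]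
  have e := h.koszulMap_fderiv_fderiv hw w.2 a.1 b.1 c.1
  rw [koszulMap_apply] at e
  simp only [_root_.add_apply, ContinuousLinearMap.comp_apply,
    ContinuousLinearMap.flip_apply, ContinuousLinearMap.coe_fst', ContinuousLinearMap.coe_snd',
    map_add, h.christoffel_spec hw, koszulMap_apply]
  -- With `w.2` moved to the front, the second derivatives form the Koszul combination of `∂_v ∂G`,
  -- which `e` evaluates.
  simp only [h.fderiv_fderiv_symm hw _ w.2]
  linarith [h.fderiv_symm hw c.1 a.1 b.2, h.fderiv_symm hw c.1 a.2 b.1,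
    h.fderiv_symm hw a.1 b.1 c.2, h.fderiv_symm hw b.1 a.1 c.2, h.fderiv_symm hw a.1 b.2 c.1,
    h.fderiv_symm hw b.1 a.2 c.1]

theorem nabla_vertical (h : IsMetricOn G U) {w : F × F} (hw : w.1 ∈ U) {β : F → F}
    (hβ : DifferentiableAt ℝ β w.1) (a : F × F) :
    chartNabla (AlmostNorden.chartLift G) (fun z ↦ (0, β z.1)) w a =
      (0, chartNabla G β w.1 a.1) := by
  have e : HasFDerivAt (fun z : F × F ↦ ((0 : F), β z.1))
      ((ContinuousLinearMap.inr ℝ F F).comp ((fderiv ℝ β w.1).comp (.fst ℝ F F))) w :=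
    (ContinuousLinearMap.inr ℝ F F).hasFDerivAt.comp w
      (hβ.hasFDerivAt.comp w hasFDerivAt_fst)
  rw [chartNabla, e.fderiv, h.christoffel_chartLift hw]
  simp [chartNabla]

/-- The field has vertical component `-Γ(v, β)`. Differentiating it contributes `-∂_a Γ(v, β)`, the
symbols of the lift contribute `∂_v Γ(β, a)`, and the two assemble to `R(v, a)β`. The terms in `a.2`
cancel. -/
theorem nabla_horizontal (h : IsMetricOn G U) {w : F × F} (hw : w.1 ∈ U) {β : F → F}
    (hβ : DifferentiableAt ℝ β w.1) (a : F × F) :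
    chartNabla (AlmostNorden.chartLift G) (fun z ↦ chartHor G z (β z.1)) w a =
      chartHor G w (chartNabla G β w.1 a.1) +
        (0, chartCurvature G w.1 w.2 a.1 (β w.1)) := by
  have hΓ := h.differentiableAt_christoffel hw
  have e1 : HasFDerivAt (fun z : F × F ↦ β z.1) ((fderiv ℝ β w.1).comp (.fst ℝ F F)) w :=
    hβ.hasFDerivAt.comp w hasFDerivAt_fst
  have e2 : HasFDerivAt (fun z : F × F ↦ chartChristoffel G z.1)
      ((fderiv ℝ (chartChristoffel G) w.1).comp (.fst ℝ F F)) w :=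
    hΓ.hasFDerivAt.comp w hasFDerivAt_fst
  have e := e1.prodMk ((e2.clm_apply (hasFDerivAt_snd (p := w))).clm_apply e1).neg
  simp only [Pi.neg_apply] at e
  simp only [chartHor_apply]
  rw [chartNabla, e.fderiv, h.christoffel_chartLift hw]
  ext
  · simp [chartNabla]
  · simp only [chartNabla, chartCurvature, Prod.snd_add, ContinuousLinearMap.prod_apply,
      _root_.neg_apply, _root_.add_apply, ContinuousLinearMap.comp_apply,
      ContinuousLinearMap.flip_apply, ContinuousLinearMap.coe_fst', ContinuousLinearMap.coe_snd',
      map_add, map_neg]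
    rw [h.fderiv_christoffel_symm hw a.1 _ w.2, h.christoffel_symm hw _ w.2,
      h.christoffel_symm hw (β w.1) a.2, h.christoffel_symm hw (β w.1) w.2]
    abel

theorem differentiableAt_chartHor (h : IsMetricOn G U) {w : F × F} (hw : w.1 ∈ U) :
    DifferentiableAt ℝ (chartHor G) w := by
  have e2 : DifferentiableAt ℝ (fun z : F × F ↦ chartChristoffel G z.1) w :=
    (h.differentiableAt_christoffel hw).comp w differentiableAt_fst
  exact (differentiableAt_const _).sub
    ((differentiableAt_const _).clm_comp (e2.clm_apply differentiableAt_snd))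

theorem differentiableAt_chartVertPart (h : IsMetricOn G U) {w : F × F} (hw : w.1 ∈ U) :
    DifferentiableAt ℝ (chartVertPart G) w := by
  have e2 : DifferentiableAt ℝ (fun z : F × F ↦ chartChristoffel G z.1) w :=
    (h.differentiableAt_christoffel hw).comp w differentiableAt_fst
  exact (differentiableAt_const _).add
    ((e2.clm_apply differentiableAt_snd).clm_comp (differentiableAt_const _))

variable {A : F → F →L[ℝ] F}

theorem differentiableAt_chartLift₁ (h : IsMetricOn G U) {w : F × F} (hw : w.1 ∈ U)
    (hA : DifferentiableAt ℝ A w.1) : DifferentiableAt ℝ (chartLift₁ G A) w := by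
  have e : DifferentiableAt ℝ (fun z : F × F ↦ A z.1) w := hA.comp w differentiableAt_fst
  exact ((h.differentiableAt_chartHor hw).clm_comp (e.clm_comp (differentiableAt_const _))).neg.add
    ((differentiableAt_const _).clm_comp (e.clm_comp (h.differentiableAt_chartVertPart hw)))

theorem differentiableAt_chartLift₂ (h : IsMetricOn G U) {w : F × F} (hw : w.1 ∈ U) :
    DifferentiableAt ℝ (chartLift₂ G) w :=
  (differentiableAt_const _).sub
    ((h.differentiableAt_chartHor hw).clm_comp (h.differentiableAt_chartVertPart hw))

theorem differentiableAt_chartLift₃ (h : IsMetricOn G U) {w : F × F} (hw : w.1 ∈ U)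
    (hA : DifferentiableAt ℝ A w.1) : DifferentiableAt ℝ (chartLift₃ G A) w := by
  have e : DifferentiableAt ℝ (fun z : F × F ↦ A z.1) w := hA.comp w differentiableAt_fst
  exact ((differentiableAt_const _).clm_comp (e.clm_comp (differentiableAt_const _))).add
    ((h.differentiableAt_chartHor hw).clm_comp (e.clm_comp (h.differentiableAt_chartVertPart hw)))

/-- A vertical direction projects to `0`, which kills both `∇β` and `R(v, ·)β`. This is why only the
horizontal-vertical half of each trace survives. -/
theorem nabla_horizontal_vertical (h : IsMetricOn G U) {w : F × F} (hw : w.1 ∈ U) {β : F → F}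
    (hβ : DifferentiableAt ℝ β w.1) (a : F) :
    chartNabla (AlmostNorden.chartLift G) (fun z ↦ chartHor G z (β z.1)) w (0, a) = 0 := by
  rw [h.nabla_horizontal hw hβ]
  simp [chartNabla_zero, chartCurvature]

theorem differentiableAt_chartHor_const (h : IsMetricOn G U) {w : F × F} (hw : w.1 ∈ U) (b : F) :
    DifferentiableAt ℝ (fun z ↦ chartHor G z b) w :=
  (hasFDerivAt_apply_const (h.differentiableAt_chartHor hw) b).differentiableAt

/-- The fibre-constant field `(0, b)` is sent to a vertical lift of a field on the base, so no
curvature enters. -/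
theorem nablaEnd_lift₁_hor_vert (h : IsMetricOn G U) {w : F × F} (hw : w.1 ∈ U)
    (hA : DifferentiableAt ℝ A w.1) (a b : F) :
    chartNablaEnd (AlmostNorden.chartLift G) (chartLift₁ G A) w (chartHor G w a) (0, b) =
      (0, chartNablaEnd G A w.1 a b) := by
  have e := chartNablaEnd_field (G := AlmostNorden.chartLift G)
    (h.differentiableAt_chartLift₁ hw hA) (differentiableAt_const ((0, b) : F × F)) (chartHor G w a)
  have e1 : ∀ z b, chartLift₁ G A z (0, b) = (0, A z.1 b) := fun z b ↦ by simp [chartLift₁]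
  simp only [e1] at e
  rw [e, h.nabla_vertical hw (hasFDerivAt_apply_const hA b).differentiableAt,
    h.nabla_vertical hw (differentiableAt_const b), e1, chartNablaEnd_field hA
    (differentiableAt_const b)]
  simp

theorem nablaEnd_lift₁_vert_hor (h : IsMetricOn G U) {w : F × F} (hw : w.1 ∈ U)
    (hA : DifferentiableAt ℝ A w.1) (a b : F) :
    chartNablaEnd (AlmostNorden.chartLift G) (chartLift₁ G A) w (0, a) (chartHor G w b) = 0 := by
  rw [chartNablaEnd_field (h.differentiableAt_chartLift₁ hw hA)
    (h.differentiableAt_chartHor_const hw b),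
    h.nabla_horizontal_vertical hw (differentiableAt_const b)]
  have e1 : ∀ z, chartLift₁ G A z (chartHor G z b) = chartHor G z (-A z.1 b) := fun z ↦ by
    simp [chartLift₁]
  simp only [e1]
  rw [h.nabla_horizontal_vertical hw (hasFDerivAt_apply_const hA b).differentiableAt.fun_neg]
  simp

/-- The structure turns the vertical lift of `b` into the horizontal lift of `-b`. The connection
terms cancel because the lifting commutes with `∇`, and the curvature term of `nabla_horizontal` is
left. -/
theorem nablaEnd_lift₂_hor_vert (h : IsMetricOn G U) {w : F × F} (hw : w.1 ∈ U) (a b : F) :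
    chartNablaEnd (AlmostNorden.chartLift G) (chartLift₂ G) w (chartHor G w a) (0, b) =
      (0, -chartCurvature G w.1 w.2 a b) := by
  have e := chartNablaEnd_field (G := AlmostNorden.chartLift G)
    (h.differentiableAt_chartLift₂ hw) (differentiableAt_const ((0, b) : F × F)) (chartHor G w a)
  have e1 : ∀ z b, chartLift₂ G z (0, b) = chartHor G z (-b) := fun z b ↦ by simp [chartLift₂]
  simp only [e1] at e
  have e2 : chartNabla G (fun _ ↦ -b) w.1 a = -chartNabla G (fun _ ↦ b) w.1 a := by
    simp [chartNabla]
  have e3 : chartCurvature G w.1 w.2 a (-b) = -chartCurvature G w.1 w.2 a b := by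
    simp only [chartCurvature, map_neg, _root_.neg_apply]
    abel
  rw [e, h.nabla_horizontal hw (differentiableAt_const (-b)),
    h.nabla_vertical hw (differentiableAt_const b), e1]
  simp [e2, e3]

theorem nablaEnd_lift₂_vert_hor (h : IsMetricOn G U) {w : F × F} (hw : w.1 ∈ U) (a b : F) :
    chartNablaEnd (AlmostNorden.chartLift G) (chartLift₂ G) w (0, a) (chartHor G w b) = 0 := by
  rw [chartNablaEnd_field (h.differentiableAt_chartLift₂ hw)
    (h.differentiableAt_chartHor_const hw b),
    h.nabla_horizontal_vertical hw (differentiableAt_const b)]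
  have e1 : ∀ z, chartLift₂ G z (chartHor G z b) = (0, b) := fun z ↦ by simp [chartLift₂]
  simp only [e1]
  rw [h.nabla_vertical hw (differentiableAt_const b)]
  simp [chartNabla_zero]

/-- Here the vertical lift becomes the horizontal lift of `A b`, so both the derivative of `A` and
the curvature applied to `A b` appear. -/
theorem nablaEnd_lift₃_hor_vert (h : IsMetricOn G U) {w : F × F} (hw : w.1 ∈ U)
    (hA : DifferentiableAt ℝ A w.1) (a b : F) :
    chartNablaEnd (AlmostNorden.chartLift G) (chartLift₃ G A) w (chartHor G w a) (0, b) =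
      chartHor G w (chartNablaEnd G A w.1 a b) +
        (0, chartCurvature G w.1 w.2 a (A w.1 b)) := by
  have e := chartNablaEnd_field (G := AlmostNorden.chartLift G)
    (h.differentiableAt_chartLift₃ hw hA) (differentiableAt_const ((0, b) : F × F)) (chartHor G w a)
  have e1 : ∀ z b, chartLift₃ G A z (0, b) = chartHor G z (A z.1 b) := fun z b ↦ by
    simp [chartLift₃]
  simp only [e1] at e
  rw [e, h.nabla_horizontal hw (hasFDerivAt_apply_const hA b).differentiableAt,
    h.nabla_vertical hw (differentiableAt_const b), e1, chartNablaEnd_field hA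
    (differentiableAt_const b), map_sub]
  have e4 : (chartHor G w a).1 = a := by simp
  rw [e4]
  abel

theorem nablaEnd_lift₃_vert_hor (h : IsMetricOn G U) {w : F × F} (hw : w.1 ∈ U)
    (hA : DifferentiableAt ℝ A w.1) (a b : F) :
    chartNablaEnd (AlmostNorden.chartLift G) (chartLift₃ G A) w (0, a) (chartHor G w b) = 0 := by
  rw [chartNablaEnd_field (h.differentiableAt_chartLift₃ hw hA)
    (h.differentiableAt_chartHor_const hw b),
    h.nabla_horizontal_vertical hw (differentiableAt_const b)]
  have e1 : ∀ z, chartLift₃ G A z (chartHor G z b) = (0, A z.1 b) := fun z ↦ by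
    simp [chartLift₃]
  simp only [e1]
  rw [h.nabla_vertical hw (hasFDerivAt_apply_const hA b).differentiableAt]
  simp [chartNabla_zero]

/-- Compatibility turns `(∂_v G)(a, c₁) - G(Γ(v, a), c₁)` into `G(a, Γ(v, c₁))`, which completes
`c₂` to the vertical part of `c`. -/
theorem chartLift_chartHor (h : IsMetricOn G U) {w : F × F} (hw : w.1 ∈ U) (a : F) (c : F × F) :
    AlmostNorden.chartLift G w (chartHor G w a) c = G w.1 a (chartVertPart G w c) := by
  simp only [chartLift_apply, chartHor_apply, chartVertPart_apply, map_neg, map_add,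
    _root_.neg_apply, h.fderiv_eq_christoffel hw]
  abel

end IsMetricOn

end Lift

section ChartComponents

variable {E : Type*} [NormedAddCommGroup E] [NormedSpace ℝ E]
  {H : Type*} [TopologicalSpace H] {I : ModelWithCorners ℝ E H}
  {M : Type*} [TopologicalSpace M] [ChartedSpace H M]

section Basic

variable [IsManifold I 1 M]

/-! ### Components in a chart -/

theorem frame_components_of_mem {p q : M} (hq : q ∈ (chartAt H p).source) (x : TangentSpace I q) :
    frame p q (components p q x) = x :=
  Trivialization.symmL_continuousLinearMapAt _ hq x

theorem components_frame_of_mem {p q : M} (hq : q ∈ (chartAt H p).source) (a : E) :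
    components (I := I) p q (frame p q a) = a :=
  Trivialization.continuousLinearMapAt_symmL _ hq a

theorem components_injective {p q : M} (hq : q ∈ (chartAt H p).source) :
    Function.Injective (components (I := I) p q) :=
  Function.LeftInverse.injective (frame_components_of_mem hq)

theorem components_eq_mfderiv {p q : M} (hq : q ∈ (chartAt H p).source) :
    components (I := I) p q = mfderiv I 𝓘(ℝ, E) (extChartAt I p) q :=
  TangentBundle.continuousLinearMapAt_trivializationAt hq

/-- The extensions used to define `covDerivEnd`, `curvature` and `horizontalLift` are
coordinate-constant on the whole chart domain, hence their derivatives and brackets vanish there. -/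
theorem extend_eq_frame {p q : M} (hq : q ∈ (chartAt H p).source) (x : TangentSpace I p) :
    (FiberBundle.extend E x : Π q : M, TangentSpace I q) q = frame p q (components p p x) := by
  rw [frame, Trivialization.symmL_apply _ hq, components,
    Trivialization.continuousLinearMapAt_apply_of_mem ℝ _
      (FiberBundle.mem_baseSet_trivializationAt' p)]
  rfl

theorem components_extend {p q : M} (hq : q ∈ (chartAt H p).source) (x : TangentSpace I p) :
    components p q ((FiberBundle.extend E x : Π q : M, TangentSpace I q) q) =
      components p p x := by
  rw [extend_eq_frame hq, components_frame_of_mem hq]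

theorem mvfderiv_eq_fderiv {V : Type*} [NormedAddCommGroup V] [NormedSpace ℝ V] {f : M → V}
    {f' : E → V} {p q : M} (hq : q ∈ (chartAt H p).source)
    (hf' : DifferentiableAt ℝ f' (extChartAt I p q))
    (hff' : f =ᶠ[nhds q] fun z ↦ f' (extChartAt I p z)) :
    mvfderiv I f q = (fderiv ℝ f' (extChartAt I p q)).comp (components p q) := by
  have h : HasMFDerivAt I 𝓘(ℝ, V) f q
      ((fderiv ℝ f' (extChartAt I p q)).comp (mfderiv I 𝓘(ℝ, E) (extChartAt I p) q)) :=
    (hf'.hasFDerivAt.hasMFDerivAt.comp q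
      (mdifferentiableAt_extChartAt hq).hasMFDerivAt).congr_of_eventuallyEq hff'
  ext x
  rw [mvfderiv, h.mfderiv, components_eq_mfderiv hq]
  rfl

variable {g : FormField I M} {p : M} {G : E → E →L[ℝ] E →L[ℝ] ℝ}

theorem metricDerivative_eq (dG : DifferentiableAt ℝ G (extChartAt I p p))
    (hG : ∀ᶠ z in nhds p, metricComponents g p z = G (extChartAt I p z)) :
    metricDerivative g p = fderiv ℝ G (extChartAt I p p) := by
  ext a : 1
  rw [metricDerivative, mvfderiv_eq_fderiv (mem_chart_source H p) dG hG]
  simp [components_frame]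

theorem christoffel_eq (dG : DifferentiableAt ℝ G (extChartAt I p p))
    (hG : ∀ᶠ z in nhds p, metricComponents g p z = G (extChartAt I p z)) (a : E) :
    christoffel g p a = chartChristoffel G (extChartAt I p p) a := by
  have h : christoffelFirst g p a = koszulMap (fderiv ℝ G (extChartAt I p p)) a := by
    ext b c
    rw [christoffelFirst_apply, metricDerivative_eq dG hG, koszulMap_apply]
  rw [christoffel, h, hG.self_of_nhds]
  rfl

/-- Only the centre of the chart is covered: there the chart is the one by which the connection is
defined. -/
theorem components_leviCivita_self (dG : DifferentiableAt ℝ G (extChartAt I p p))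
    (hG : ∀ᶠ z in nhds p, metricComponents g p z = G (extChartAt I p z))
    {σ : Π q : M, TangentSpace I q} {s : E → E} (ds : DifferentiableAt ℝ s (extChartAt I p p))
    (hs : ∀ᶠ z in nhds p, components p z (σ z) = s (extChartAt I p z)) (x : TangentSpace I p) :
    components p p (leviCivita g σ p x) =
      chartNabla G s (extChartAt I p p) (components p p x) := by
  have h : leviCivita g σ p x = frame p p (mvfderiv I (fun q ↦ components p q (σ q)) p x +
      christoffel g p (components p p (σ p)) (components p p x)) := rfl
  rw [h, components_frame, mvfderiv_eq_fderiv (mem_chart_source H p) ds hs, christoffel_eq dG hG,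
    hs.self_of_nhds]
  rfl

theorem components_covDerivEnd (dG : DifferentiableAt ℝ G (extChartAt I p p))
    (hG : ∀ᶠ z in nhds p, metricComponents g p z = G (extChartAt I p z))
    {A : EndField I M} {B : E → E →L[ℝ] E} (dB : DifferentiableAt ℝ B (extChartAt I p p))
    (hB : ∀ᶠ z in nhds p, ∀ b, components p z (A z (frame p z b)) = B (extChartAt I p z) b)
    (x y : TangentSpace I p) :
    components p p (covDerivEnd (leviCivita g) A p x y) =
      chartNablaEnd G B (extChartAt I p p) (components p p x) (components p p y) := by
  have hmem : ∀ᶠ z in nhds p, z ∈ (chartAt H p).source :=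
    (chartAt H p).open_source.mem_nhds (mem_chart_source H p)
  have e1 := components_leviCivita_self dG hG
    (σ := fun q ↦ A q ((FiberBundle.extend E y : Π q : M, TangentSpace I q) q))
    (s := fun z ↦ B z (components p p y))
    (hasFDerivAt_apply_const dB _).differentiableAt (by
      filter_upwards [hB, hmem] with z hz hz'
      rw [extend_eq_frame hz', hz]) x
  have e2 := components_leviCivita_self dG hG
    (σ := (FiberBundle.extend E y : Π q : M, TangentSpace I q))
    (s := fun _ ↦ components p p y) (differentiableAt_const _) (by
      filter_upwards [hmem] with z hz' using components_extend hz' y) x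
  rw [covDerivEnd, map_sub, e1, ← frame_components p (leviCivita g _ p x), hB.self_of_nhds, e2,
    chartNablaEnd_field dB (differentiableAt_const (components p p y))]

theorem form_covDerivEnd (dG : DifferentiableAt ℝ G (extChartAt I p p))
    (hG : ∀ᶠ z in nhds p, metricComponents g p z = G (extChartAt I p z))
    {A : EndField I M} {B : E → E →L[ℝ] E} (dB : DifferentiableAt ℝ B (extChartAt I p p))
    (hB : ∀ᶠ z in nhds p, ∀ b, components p z (A z (frame p z b)) = B (extChartAt I p z) b)
    (x y z : TangentSpace I p) :
    g p (covDerivEnd (leviCivita g) A p x y) z =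
      G (extChartAt I p p) (chartNablaEnd G B (extChartAt I p p) (components p p x)
        (components p p y)) (components p p z) := by
  rw [← components_covDerivEnd dG hG dB hB, ← hG.self_of_nhds, metricComponents, pullForm_apply,
    frame_components, frame_components]

end Basic

theorem extChartAt_symm_extChartAt {p q : M} (hq : q ∈ (chartAt H p).source) :
    (extChartAt I p).symm (extChartAt I p q) = q :=
  (extChartAt I p).left_inv (by rwa [extChartAt_source])

theorem eventually_nhds_extChartAt [I.Boundaryless] {p q : M} (hq : q ∈ (chartAt H p).source) {P : E → Prop}
    (h : ∀ᶠ z in nhds q, P (extChartAt I p z)) : ∀ᶠ y in nhds (extChartAt I p q), P y := by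
  have hq' : q ∈ (extChartAt I p).source := by rwa [extChartAt_source]
  have ht : (extChartAt I p).target ∈ nhds (extChartAt I p q) :=
    (isOpen_extChartAt_target p).mem_nhds ((extChartAt I p).map_source hq')
  have hc : Filter.Tendsto (extChartAt I p).symm (nhds (extChartAt I p q)) (nhds q) := by
    have := continuousAt_extChartAt_symm' hq'
    rwa [ContinuousAt, extChartAt_symm_extChartAt hq] at this
  filter_upwards [hc.eventually h, ht] with y hy hyt
  rwa [(extChartAt I p).right_inv hyt] at hy

theorem extChartAt_mem_target {p q : M} (hq : q ∈ (chartAt H p).source) :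
    extChartAt I p q ∈ (extChartAt I p).target :=
  (extChartAt I p).map_source ((extChartAt_source I p).symm ▸ hq)

/-! ### Transition maps and independence of the chart -/

section Smooth

variable [IsManifold I ∞ M]

/-- The components of a metric in the preferred chart at `p`, as a function on the model space. -/
def chartMetric (g : FormField I M) (p : M) (y : E) : E →L[ℝ] E →L[ℝ] ℝ :=
  metricComponents g p ((extChartAt I p).symm y)

theorem chartMetric_extChartAt (g : FormField I M) {p q : M} (hq : q ∈ (chartAt H p).source) :
    chartMetric g p (extChartAt I p q) = metricComponents g p q := by
  rw [chartMetric, extChartAt_symm_extChartAt hq]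

theorem eventually_mem_chart_source {p q : M} (hq : q ∈ (chartAt H p).source) :
    ∀ᶠ z in nhds q, z ∈ (chartAt H p).source :=
  (chartAt H p).open_source.mem_nhds hq

theorem form_eq_chartMetric (g : FormField I M) {p q : M} (hq : q ∈ (chartAt H p).source)
    (x y : TangentSpace I q) :
    g q x y = chartMetric g p (extChartAt I p q) (components p q x) (components p q y) := by
  rw [chartMetric_extChartAt g hq, metricComponents, pullForm_apply, frame_components_of_mem hq,
    frame_components_of_mem hq]

theorem eventually_chartMetric (g : FormField I M) (p : M) :
    ∀ᶠ z in nhds p, metricComponents g p z = chartMetric g p (extChartAt I p z) := by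
  filter_upwards [eventually_mem_chart_source (mem_chart_source H p)] with z hz
  exact (chartMetric_extChartAt g hz).symm

variable [I.Boundaryless]

/-- The change of trivialization of the tangent bundle is the derivative of the transition map; this
converts frames and components into the calculus of coordinate changes. -/
theorem fderiv_transition {p q z : M} (hp : z ∈ (chartAt H p).source)
    (hq : z ∈ (chartAt H q).source) :
    fderiv ℝ (extChartAt I q ∘ (extChartAt I p).symm) (extChartAt I p z) =
      (components (I := I) q z).comp (frame p z) := by
  ext a
  rw [components, frame, ContinuousLinearMap.comp_apply,
    TangentBundle.continuousLinearMapAt_trivializationAt_eq_core hq,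
    TangentBundle.symmL_trivializationAt_eq_core hp]
  refine Eq.trans ?_ (tangentCoordChange_comp (I := I) (v := a) (w := p) (x := z) (y := q) (z := z)
    ⟨⟨?_, ?_⟩, ?_⟩).symm
  · rw [tangentCoordChange_def, I.range_eq_univ, fderivWithin_univ]
  · rwa [extChartAt_source]
  · exact mem_extChartAt_source z
  · rwa [extChartAt_source]

theorem contDiffAt_transition {p q z : M} (hp : z ∈ (chartAt H p).source)
    (hq : z ∈ (chartAt H q).source) :
    ContDiffAt ℝ ∞ (extChartAt I q ∘ (extChartAt I p).symm) (extChartAt I p z) := by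
  have h := contDiffWithinAt_ext_coord_change (I := I) (n := ∞) q p (y := extChartAt I p z) (by
    rw [PartialEquiv.trans_source'', PartialEquiv.symm_symm, PartialEquiv.symm_target]
    refine Set.mem_image_of_mem _ ⟨?_, ?_⟩ <;> rwa [extChartAt_source])
  rwa [I.range_eq_univ, contDiffWithinAt_univ] at h

theorem chartMetric_transition (g : FormField I M) {p q z : M} (hp : z ∈ (chartAt H p).source)
    (hq : z ∈ (chartAt H q).source) : ∀ᶠ y in nhds (extChartAt I p z), ∀ a b,
    chartMetric g p y a b = chartMetric g q ((extChartAt I q ∘ (extChartAt I p).symm) y)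
      (fderiv ℝ (extChartAt I q ∘ (extChartAt I p).symm) y a)
      (fderiv ℝ (extChartAt I q ∘ (extChartAt I p).symm) y b) := by
  refine eventually_nhds_extChartAt hp ?_
  filter_upwards [eventually_mem_chart_source hp, eventually_mem_chart_source hq] with z hz hz' a b
  rw [fderiv_transition hz hz', chartMetric_extChartAt g hz, Function.comp_apply,
    extChartAt_symm_extChartAt hz, chartMetric_extChartAt g hz', metricComponents, metricComponents]
  simp only [pullForm_apply, ContinuousLinearMap.comp_apply, frame_components_of_mem hz']

theorem fderiv_transition_surjective {p q z : M} (hp : z ∈ (chartAt H p).source)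
    (hq : z ∈ (chartAt H q).source) : Function.Surjective
      (fderiv ℝ (extChartAt I q ∘ (extChartAt I p).symm) (extChartAt I p z)) := fun a ↦ by
  refine ⟨components (I := I) p z (frame q z a), ?_⟩
  rw [fderiv_transition hp hq, ContinuousLinearMap.comp_apply, frame_components_of_mem hp,
    components_frame_of_mem hq]

variable [FiniteDimensional ℝ E]
variable {g : FormField I M}

theorem christoffel_transition (h : ∀ p, IsMetricOn (chartMetric g p) (extChartAt I p).target)
    {p q z : M} (hp : z ∈ (chartAt H p).source) (hq : z ∈ (chartAt H q).source) (a b : E) :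
    fderiv ℝ (extChartAt I q ∘ (extChartAt I p).symm) (extChartAt I p z)
        (chartChristoffel (chartMetric g p) (extChartAt I p z) a b) =
      chartChristoffel (chartMetric g q) (extChartAt I q z)
        (fderiv ℝ (extChartAt I q ∘ (extChartAt I p).symm) (extChartAt I p z) a)
        (fderiv ℝ (extChartAt I q ∘ (extChartAt I p).symm) (extChartAt I p z) b) +
      fderiv ℝ (fderiv ℝ (extChartAt I q ∘ (extChartAt I p).symm)) (extChartAt I p z) a b := by
  have e : (extChartAt I q ∘ (extChartAt I p).symm) (extChartAt I p z) = extChartAt I q z := by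
    rw [Function.comp_apply, extChartAt_symm_extChartAt hp]
  have key := (h p).fderiv_christoffel (h q) (extChartAt_mem_target hp)
    (by rw [e]; exact extChartAt_mem_target hq)
    ((contDiffAt_transition hp hq).of_le (WithTop.coe_le_coe.2 le_top))
    (fderiv_transition_surjective hp hq) (chartMetric_transition g hp hq) a b
  rwa [e] at key

/-- At `q` the connection is defined by the chart at `q`. The field is pushed to that chart by the
transition map `τ`, the formula at the centre is applied, and `fderiv_nabla` carries the result back
to the chart at `p`. -/
theorem components_leviCivita (h : ∀ p, IsMetricOn (chartMetric g p) (extChartAt I p).target)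
    {p q : M} (hq : q ∈ (chartAt H p).source) {σ : Π q : M, TangentSpace I q} {s : E → E}
    (ds : DifferentiableAt ℝ s (extChartAt I p q))
    (hs : ∀ᶠ z in nhds q, components p z (σ z) = s (extChartAt I p z)) (x : TangentSpace I q) :
    components p q (leviCivita g σ q x) =
      chartNabla (chartMetric g p) s (extChartAt I p q) (components p q x) := by
  set τ := extChartAt I q ∘ (extChartAt I p).symm with hτ
  set τ' := extChartAt I p ∘ (extChartAt I q).symm with hτ'
  have hqq := mem_chart_source H q
  have near := eventually_mem_chart_source hq
  have near' := eventually_mem_chart_source hqq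
  have hτz : ∀ z ∈ (chartAt H p).source, τ (extChartAt I p z) = extChartAt I q z := fun z hz ↦ by
    rw [hτ, Function.comp_apply, extChartAt_symm_extChartAt hz]
  have hτz' : ∀ z ∈ (chartAt H q).source, τ' (extChartAt I q z) = extChartAt I p z := fun z hz ↦ by
    rw [hτ', Function.comp_apply, extChartAt_symm_extChartAt hz]
  have cτ : ContDiffAt ℝ ∞ τ (extChartAt I p q) := contDiffAt_transition hq hqq
  have cτ' : ContDiffAt ℝ ∞ τ' (extChartAt I q q) := contDiffAt_transition hqq hq
  have dτ : DifferentiableAt ℝ (fderiv ℝ τ) (extChartAt I p q) :=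
    (cτ.fderiv_right (m := ∞) (by simp)).differentiableAt (by simp)
  have hpq : fderiv ℝ τ (extChartAt I p q) = (components (I := I) q q).comp (frame p q) :=
    fderiv_transition hq hqq
  -- The components of the field in the chart at `q`, obtained from `s` by push-forward along `τ`.
  have ds' : DifferentiableAt ℝ (fun y ↦ fderiv ℝ τ (τ' y) (s (τ' y))) (extChartAt I q q) := by
    have e := hτz' q hqq
    have d1 : DifferentiableAt ℝ τ' (extChartAt I q q) := cτ'.differentiableAt (by simp)
    rw [← e] at dτ ds
    exact (dτ.comp _ d1).clm_apply (ds.comp _ d1)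
  have main := components_leviCivita_self ((h q).differentiableAt (mem_extChartAt_target q))
    (eventually_chartMetric g q) ds' (σ := σ) (by
      filter_upwards [near, near', hs] with z hz hz' hsz
      rw [hτz' z hz', fderiv_transition hz hz', ← hsz, ContinuousLinearMap.comp_apply,
        frame_components_of_mem hz]) x
  have inv := (h p).fderiv_nabla (h q) (τ := τ) (y := extChartAt I p q)
    (extChartAt_mem_target hq)
    (by rw [hτz q hq]; exact mem_extChartAt_target q) (cτ.of_le (WithTop.coe_le_coe.2 le_top))
    (fderiv_transition_surjective hq hqq) (chartMetric_transition g hq hqq)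
    ds (s' := fun y ↦ fderiv ℝ τ (τ' y) (s (τ' y))) (by rw [hτz q hq]; exact ds')
    (eventually_nhds_extChartAt hq (by
      filter_upwards [near, near'] with z hz hz'
      rw [hτz z hz, hτz' z hz'])) (components p q x)
  rw [hτz q hq, hpq] at inv
  simp only [ContinuousLinearMap.comp_apply, frame_components_of_mem hq] at inv
  rw [inv] at main
  rw [components_injective hqq main, components_frame_of_mem hq]

end Smooth

end ChartComponents

section LeviCivitaChart

variable {E : Type*} [NormedAddCommGroup E] [NormedSpace ℝ E]
  {H : Type*} [TopologicalSpace H] {I : ModelWithCorners ℝ E H} [I.Boundaryless]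
  {M : Type*} [TopologicalSpace M] [ChartedSpace H M] [IsManifold I ∞ M]

/-! ### The curvature in a chart -/

theorem mlieBracket_extend (p : M) (x y : TangentSpace I p) :
    VectorField.mlieBracket I (FiberBundle.extend E x : Π q : M, TangentSpace I q)
      (FiberBundle.extend E y : Π q : M, TangentSpace I q) p = 0 := by
  have key : ∀ x : TangentSpace I p, VectorField.mpullbackWithin 𝓘(ℝ, E) I (extChartAt I p).symm
      (FiberBundle.extend E x : Π q : M, TangentSpace I q) (Set.range I) =ᶠ[nhds (extChartAt I p p)]
      fun _ ↦ components p p x := by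
    intro x
    filter_upwards [(isOpen_extChartAt_target p).mem_nhds (mem_extChartAt_target (I := I) p)] with z hz
    have hz' : (extChartAt I p).symm z ∈ (chartAt H p).source := by
      rw [← extChartAt_source I]
      exact (extChartAt I p).map_target hz
    rw [VectorField.mpullbackWithin_apply]
    refine (isInvertible_mfderivWithin_extChartAt_symm hz).inverse_apply_eq.2 ?_
    rw [extend_eq_frame hz', frame, TangentBundle.symmL_trivializationAt hz',
      (extChartAt I p).right_inv hz]
    rfl
  have bracket : ∀ (V W : E → E) (a b z : E), (V =ᶠ[nhds z] fun _ ↦ a) → (W =ᶠ[nhds z] fun _ ↦ b) →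
      VectorField.lieBracketWithin ℝ V W Set.univ z = 0 := by
    intro V W a b z hV hW
    rw [VectorField.lieBracketWithin_univ, hV.lieBracket_vectorField_eq hW]
    simp [VectorField.lieBracket]
  rw [← VectorField.mlieBracketWithin_univ, VectorField.mlieBracketWithin_apply, Set.preimage_univ,
    Set.univ_inter]
  have h := bracket _ _ _ _ _ (key x) (key y)
  rw [← I.range_eq_univ] at h
  exact (congrArg _ h).trans (map_zero _)

variable [FiniteDimensional ℝ E] {g : FormField I M}

/-- The inner covariant derivative is needed at all points near `p` in the fixed chart at `p`, hence
`first`; the outer one is then the derivative of a Christoffel symbol. The bracket term drops out.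
-/
theorem components_curvature (h : ∀ p, IsMetricOn (chartMetric g p) (extChartAt I p).target)
    (p : M) (x y z : TangentSpace I p) :
    components p p (curvature (leviCivita g) p x y z) =
      chartCurvature (chartMetric g p) (extChartAt I p p) (components p p x) (components p p y)
        (components p p z) := by
  have hp : p ∈ (chartAt H p).source := mem_chart_source H p
  have near := eventually_mem_chart_source hp
  have dΓ := (h p).differentiableAt_christoffel (mem_extChartAt_target (I := I) p)
  have first : ∀ y : TangentSpace I p, ∀ q ∈ (chartAt H p).source,
      components p q (leviCivita g (FiberBundle.extend E z : Π q : M, TangentSpace I q) q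
        ((FiberBundle.extend E y : Π q : M, TangentSpace I q) q)) =
      chartChristoffel (chartMetric g p) (extChartAt I p q) (components p p z)
        (components p p y) := by
    intro y q hq
    rw [components_leviCivita h hq (s := fun _ ↦ components p p z) (differentiableAt_const _)
      ((eventually_mem_chart_source hq).mono fun q hq ↦ components_extend hq z),
      components_extend hq, chartNabla]
    simp
  have second : ∀ x y : TangentSpace I p,
      components p p (leviCivita g (fun q ↦ leviCivita g (FiberBundle.extend E z :
        Π q : M, TangentSpace I q) q ((FiberBundle.extend E y : Π q : M, TangentSpace I q) q)) p x) =
      fderiv ℝ (chartChristoffel (chartMetric g p)) (extChartAt I p p) (components p p x)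
        (components p p z) (components p p y) +
      chartChristoffel (chartMetric g p) (extChartAt I p p)
        (chartChristoffel (chartMetric g p) (extChartAt I p p) (components p p z)
          (components p p y)) (components p p x) := by
    intro x y
    have hd := hasFDerivAt_apply_const₂ dΓ (components p p z) (components p p y)
    rw [components_leviCivita h hp hd.differentiableAt (near.mono fun q hq ↦ first y q hq),
      chartNabla, hd.fderiv]
    rfl
  simp only [curvature, mlieBracket_extend, map_zero, sub_zero, map_sub, second, chartCurvature]

end LeviCivitaChart

section Smoothness

variable {E : Type*} [NormedAddCommGroup E] [NormedSpace ℝ E]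
  {H : Type*} [TopologicalSpace H] {I : ModelWithCorners ℝ E H}
  {M : Type*} [TopologicalSpace M] [ChartedSpace H M] [IsManifold I ∞ M]

/-! ### Smoothness in a chart -/

/-- The components of a field of endomorphisms in the preferred chart at `p`, as a function on the
model space. -/
def chartEnd (A : EndField I M) (p : M) (y : E) : E →L[ℝ] E :=
  (components p ((extChartAt I p).symm y)).comp
    ((A ((extChartAt I p).symm y)).comp (frame p ((extChartAt I p).symm y)))

theorem components_end (A : EndField I M) {p q : M} (hq : q ∈ (chartAt H p).source)
    (x : TangentSpace I q) :
    components p q (A q x) = chartEnd A p (extChartAt I p q) (components p q x) := by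
  rw [chartEnd, extChartAt_symm_extChartAt hq, ContinuousLinearMap.comp_apply,
    ContinuousLinearMap.comp_apply, frame_components_of_mem hq]

theorem contMDiffAt_frame {p q : M} (hq : q ∈ (chartAt H p).source) (a : E) :
    ContMDiffAt I (I.prod 𝓘(ℝ, E)) ∞
      (fun z ↦ TotalSpace.mk' E (E := (TangentSpace I : M → Type _)) z (frame p z a)) q := by
  rw [(trivializationAt E (TangentSpace I : M → Type _) p).contMDiffAt_section_iff
    (s := fun z ↦ frame (I := I) p z a) hq]
  refine (contMDiffAt_const (c := a)).congr_of_eventuallyEq ?_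
  filter_upwards [eventually_mem_chart_source hq] with z hz
  rw [← Trivialization.continuousLinearMapAt_apply_of_mem ℝ _ hz]
  exact components_frame_of_mem hz a

variable [I.Boundaryless]

theorem contDiffOn_chart {V : Type*} [NormedAddCommGroup V] [NormedSpace ℝ V] {p : M} {f : M → V}
    (hf : ∀ q ∈ (chartAt H p).source, ContMDiffAt I 𝓘(ℝ, V) ∞ f q) :
    ContDiffOn ℝ ∞ (fun y ↦ f ((extChartAt I p).symm y)) (extChartAt I p).target := by
  intro y hy
  have hz : (extChartAt I p).symm y ∈ (chartAt H p).source := by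
    rw [← extChartAt_source I]
    exact (extChartAt I p).map_target hy
  have h1 : ContMDiffAt 𝓘(ℝ, E) I ∞ (extChartAt I p).symm y :=
    (contMDiffOn_extChartAt_symm p).contMDiffAt ((isOpen_extChartAt_target p).mem_nhds hy)
  exact ((hf _ hz).comp y h1).contDiffAt.contDiffWithinAt

variable [FiniteDimensional ℝ E] (S : AlmostNordenStructure I M)

theorem AlmostNordenStructure.isMetricOn (p : M) :
    IsMetricOn (chartMetric S.g p) (extChartAt I p).target where
  isOpen := isOpen_extChartAt_target p
  contDiffOn := by
    refine contDiffOn_clm_apply.2 fun a ↦ contDiffOn_clm_apply.2 fun b ↦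
      contDiffOn_chart (f := fun q ↦ S.g q (frame p q a) (frame p q b)) fun q hq ↦ ?_
    have h : ContMDiffAt I (I.prod 𝓘(ℝ)) ∞ (fun z ↦ TotalSpace.mk' ℝ (E := Bundle.Trivial M ℝ) z
        (S.g z (frame p z a) (frame p z b))) q := by
      apply ContMDiffAt.clm_bundle_apply₂ (F₁ := E) (F₂ := E)
      · exact S.g_smooth.contMDiffAt
      · exact contMDiffAt_frame hq a
      · exact contMDiffAt_frame hq b
    simp only [contMDiffAt_totalSpace] at h
    exact h.2
  symm y _ a b := S.g_symm _ _ _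
  nondegenerate y hy a ha := by
    have hz : (extChartAt I p).symm y ∈ (chartAt H p).source := by
      rw [← extChartAt_source I]
      exact (extChartAt I p).map_target hy
    have h0 : frame (I := I) p ((extChartAt I p).symm y) a = 0 := S.g_nondegenerate _ _ fun v ↦ by
      rw [← frame_components_of_mem hz v]
      exact ha _
    rw [← components_frame_of_mem (I := I) hz a, h0, map_zero]

theorem AlmostNordenStructure.differentiableAt_chartEnd (p : M) :
    DifferentiableAt ℝ (chartEnd S.J p) (extChartAt I p p) := by
  have h : ContDiffOn ℝ ∞ (chartEnd S.J p) (extChartAt I p).target := by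
    refine contDiffOn_clm_apply.2 fun a ↦ contDiffOn_chart
      (f := fun q ↦ components p q (S.J q (frame p q a))) fun q hq ↦ ?_
    have h : ContMDiffAt I (I.prod 𝓘(ℝ, E)) ∞
        (fun z ↦ TotalSpace.mk' E (E := (TangentSpace I : M → Type _)) z
          (S.J z (frame p z a))) q := by
      apply ContMDiffAt.clm_bundle_apply (F₁ := E)
      · exact S.J_smooth.contMDiffAt
      · exact contMDiffAt_frame hq a
    rw [(trivializationAt E (TangentSpace I : M → Type _) p).contMDiffAt_section_iff
      (s := fun z ↦ S.J z (frame (I := I) p z a)) hq] at h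
    refine h.congr_of_eventuallyEq ?_
    filter_upwards [eventually_mem_chart_source hq] with z hz
    exact Trivialization.continuousLinearMapAt_apply_of_mem ℝ _ hz _
  exact (h.contDiffAt ((isOpen_extChartAt_target p).mem_nhds (mem_extChartAt_target p))).differentiableAt
    (by simp)

end Smoothness

section MetricTrace

/-! ### Traces with respect to a metric -/

variable {V W : Type*} [AddCommGroup V] [Module ℝ V] [TopologicalSpace V] [FiniteDimensional ℝ V]
  [AddCommGroup W] [Module ℝ W] [TopologicalSpace W] [FiniteDimensional ℝ W]

theorem metricTrace_add (g : V →L[ℝ] V →L[ℝ] ℝ) (B B' : V → V → ℝ) :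
    metricTrace g (fun x y ↦ B x y + B' x y) = metricTrace g B + metricTrace g B' := by
  simp only [metricTrace, mul_add, Finset.sum_add_distrib]

theorem metricTrace_neg (g : V →L[ℝ] V →L[ℝ] ℝ) (B : V → V → ℝ) :
    metricTrace g (fun x y ↦ -B x y) = -metricTrace g B := by
  simp only [metricTrace, mul_neg, Finset.sum_neg_distrib]

theorem metricTrace_zero (g : V →L[ℝ] V →L[ℝ] ℝ) : metricTrace g (fun _ _ ↦ 0) = 0 := by
  simp [metricTrace]

/-- If `m` is the Gram matrix and `L` also denotes the matrix of the operator, then `B` has matrix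
`Lᵀ m`, and contraction with `m⁻¹` leaves `tr L`. This also gives independence of the basis. -/
theorem metricTrace_eq_trace {g : V →L[ℝ] V →L[ℝ] ℝ} (hs : ∀ x y, g x y = g y x)
    (hn : ∀ x, (∀ y, g x y = 0) → x = 0) {B : V → V → ℝ} (L : V →ₗ[ℝ] V)
    (hB : ∀ x y, B x y = g (L x) y) : metricTrace g B = LinearMap.trace ℝ V L := by
  set e := Module.finBasis ℝ V with he
  set m : Matrix _ _ ℝ := Matrix.of fun k l ↦ g (e k) (e l) with hm
  -- A kernel vector of `m` gives a vector orthogonal to the basis, which is zero by nondegeneracy.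
  have hu : IsUnit m := by
    rw [← Matrix.mulVec_injective_iff_isUnit, ← Matrix.coe_mulVecLin, injective_iff_map_eq_zero]
    intro v hv
    have h0 : ∑ l, v l • e l = 0 := by
      refine hn _ fun y ↦ ?_
      rw [hs]
      have h1 : ∀ k, g (e k) (∑ l, v l • e l) = 0 := fun k ↦ by
        have := congrFun hv k
        simp only [Matrix.mulVecLin_apply, Matrix.mulVec, dotProduct, hm, Matrix.of_apply,
          Pi.zero_apply] at this
        simp only [map_sum, map_smul, smul_eq_mul]
        rw [← this]
        exact Finset.sum_congr rfl fun l _ ↦ mul_comm _ _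
      generalize ∑ l, v l • e l = s at h1 ⊢
      have h2 : (g : V →ₗ[ℝ] (V →L[ℝ] ℝ)) y s = 0 := by
        rw [← e.sum_repr y]
        simp only [map_sum, map_smul, ContinuousLinearMap.coe_coe, _root_.sum_apply,
          _root_.smul_apply, h1, smul_zero, Finset.sum_const_zero]
      exact h2
    ext k
    exact Fintype.linearIndependent_iff.1 e.linearIndependent v h0 k
  have hmt : m.transpose = m := by
    ext k l
    exact hs _ _
  have hinv : m * m⁻¹ = 1 := Matrix.mul_nonsing_inv _ ((Matrix.isUnit_iff_isUnit_det _).1 hu)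
  have hit : ∀ i j, m⁻¹ i j = m⁻¹ j i := fun i j ↦ by
    have : (m⁻¹).transpose = m⁻¹ := by rw [Matrix.transpose_nonsing_inv, hmt]
    exact (congrFun (congrFun this j) i)
  have hBe : ∀ i j, B (e i) (e j) = ∑ k, LinearMap.toMatrix e e L k i * m k j := fun i j ↦ by
    rw [hB]
    conv_lhs => rw [← e.sum_repr (L (e i))]
    simp only [map_sum, map_smul, _root_.sum_apply, _root_.smul_apply, smul_eq_mul,
      LinearMap.toMatrix_apply, hm, Matrix.of_apply]
  rw [LinearMap.trace_eq_matrix_trace ℝ e, metricTrace, Matrix.trace]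
  refine Finset.sum_congr rfl fun i _ ↦ ?_
  simp only [← he, ← hm, hBe, Finset.mul_sum]
  rw [Finset.sum_comm]
  have h3 : ∀ k, ∑ j, m⁻¹ i j * (LinearMap.toMatrix e e L k i * m k j) =
      LinearMap.toMatrix e e L k i * (1 : Matrix _ _ ℝ) k i := fun k ↦ by
    rw [← hinv, Matrix.mul_apply, Finset.mul_sum]
    refine Finset.sum_congr rfl fun j _ ↦ ?_
    rw [hit i j]
    ring
  simp [h3, Matrix.one_apply]

theorem exists_linearMap_of_nondegenerate {g : V →L[ℝ] V →L[ℝ] ℝ}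
    (hn : ∀ x, (∀ y, g x y = 0) → x = 0) (B : V →ₗ[ℝ] V →ₗ[ℝ] ℝ) :
    ∃ L : V →ₗ[ℝ] V, ∀ x y, B x y = g (L x) y := by
  let g' : V →ₗ[ℝ] Module.Dual ℝ V :=
    { toFun := fun x ↦ (g x).toLinearMap
      map_add' := fun x y ↦ by ext; simp
      map_smul' := fun r x ↦ by ext; simp }
  have hi : Function.Injective g' := by
    rw [injective_iff_map_eq_zero]
    exact fun x hx ↦ hn x fun y ↦ DFunLike.congr_fun hx y
  have hs := (LinearMap.injective_iff_surjective_of_finrank_eq_finrank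
    (Subspace.dual_finrank_eq (K := ℝ) (V := V)).symm).1 hi
  let e := LinearEquiv.ofBijective g' ⟨hi, hs⟩
  refine ⟨e.symm.toLinearMap.comp B, fun x y ↦ ?_⟩
  exact (DFunLike.congr_fun (e.apply_symm_apply (B x)) y).symm

/-- The trace with respect to a neutral metric that pairs two copies of `V`. -/
theorem metricTrace_prod {g : V →L[ℝ] V →L[ℝ] ℝ} (hs : ∀ x y, g x y = g y x)
    (hn : ∀ x, (∀ y, g x y = 0) → x = 0) {g' : W →L[ℝ] W →L[ℝ] ℝ} (Φ : (V × V) ≃ₗ[ℝ] W)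
    (hg : ∀ a b, g' (Φ a) (Φ b) = g a.1 b.2 + g a.2 b.1) (B : W →ₗ[ℝ] W →ₗ[ℝ] ℝ) :
    metricTrace g' (fun x y ↦ B x y) =
      metricTrace g (fun x y ↦ B (Φ (x, 0)) (Φ (0, y))) +
        metricTrace g (fun x y ↦ B (Φ (0, x)) (Φ (y, 0))) := by
  have hs' : ∀ x y, g' x y = g' y x := fun x y ↦ by
    obtain ⟨a, rfl⟩ := Φ.surjective x
    obtain ⟨b, rfl⟩ := Φ.surjective y
    rw [hg, hg, hs a.1, hs a.2, add_comm]
  have hn' : ∀ x, (∀ y, g' x y = 0) → x = 0 := fun x hx ↦ by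
    obtain ⟨a, rfl⟩ := Φ.surjective x
    have h1 : a.1 = 0 := hn _ fun y ↦ by simpa [hg] using hx (Φ (0, y))
    have h2 : a.2 = 0 := hn _ fun y ↦ by simpa [hg] using hx (Φ (y, 0))
    rw [show a = 0 from Prod.ext h1 h2, map_zero]
  obtain ⟨L, hL⟩ := exists_linearMap_of_nondegenerate hn' B
  set K : (V × V) →ₗ[ℝ] (V × V) := Φ.symm.toLinearMap ∘ₗ L ∘ₗ Φ.toLinearMap with hK
  have hΦK : ∀ a, Φ (K a) = L (Φ a) := fun a ↦ by simp [hK]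
  have e1 := metricTrace_eq_trace hs hn (B := fun x y ↦ B (Φ (x, 0)) (Φ (0, y)))
    (LinearMap.fst ℝ V V ∘ₗ K ∘ₗ LinearMap.inl ℝ V V) fun x y ↦ by
      rw [hL, ← hΦK, hg]
      simp
  have e2 := metricTrace_eq_trace hs hn (B := fun x y ↦ B (Φ (0, x)) (Φ (y, 0)))
    (LinearMap.snd ℝ V V ∘ₗ K ∘ₗ LinearMap.inr ℝ V V) fun x y ↦ by
      rw [hL, ← hΦK, hg]
      simp
  -- Splitting `K` into its two block rows and using cyclicity of the trace gives the sum of the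
  -- traces of the diagonal blocks. Since the metric is off-diagonal, these blocks come from the
  -- mixed values of `B`.
  have hsum : K = LinearMap.inl ℝ V V ∘ₗ (LinearMap.fst ℝ V V ∘ₗ K) +
      LinearMap.inr ℝ V V ∘ₗ (LinearMap.snd ℝ V V ∘ₗ K) := by
    refine LinearMap.ext fun a ↦ ?_
    simp
  have htr : LinearMap.trace ℝ W L = LinearMap.trace ℝ (V × V) K := by
    rw [hK, LinearMap.trace_comp_comm', LinearMap.comp_assoc]
    congr 1
    ext x
    simp
  rw [metricTrace_eq_trace hs' hn' L hL, e1, e2, htr]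
  conv_lhs => rw [hsum]
  rw [map_add, LinearMap.trace_comp_comm', LinearMap.trace_comp_comm' _ (LinearMap.inr ℝ V V)]
  rfl

end MetricTrace

section TangentBundleChart

variable {E : Type*} [NormedAddCommGroup E] [NormedSpace ℝ E]
  {H : Type*} [TopologicalSpace H] {I : ModelWithCorners ℝ E H}
  {M : Type*} [TopologicalSpace M] [ChartedSpace H M] [IsManifold I ∞ M]

/-! ### Charts of the tangent bundle -/

theorem mem_chart_source_tangent {u w : TangentBundle I M}
    (hw : w.proj ∈ (chartAt H u.proj).source) : w ∈ (chartAt (ModelProd H E) u).source :=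
  (TangentBundle.mem_chart_source_iff w u).2 hw

theorem extChartAt_tangent {u w : TangentBundle I M} (hw : w.proj ∈ (chartAt H u.proj).source) :
    extChartAt I.tangent u w =
      (extChartAt I u.proj w.proj, components u.proj w.proj w.snd) := by
  rw [FiberBundle.extChartAt]
  exact Prod.ext rfl (Trivialization.continuousLinearMapAt_apply_of_mem ℝ
    (trivializationAt E (TangentSpace I : M → Type _) u.proj) hw w.snd).symm

theorem eventually_proj_mem {u w : TangentBundle I M} (hw : w.proj ∈ (chartAt H u.proj).source) :
    ∀ᶠ z in nhds w, z.proj ∈ (chartAt H u.proj).source := by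
  filter_upwards [eventually_mem_chart_source (mem_chart_source_tangent hw)] with z hz
  exact (TangentBundle.mem_chart_source_iff z u).1 hz

variable [I.Boundaryless]

/-- The transition map of the tangent bundle is `(x, v) ↦ (τ x, Dτ_x v)`; this is its derivative. -/
theorem components_frame_tangent {u w : TangentBundle I M}
    (hw : w.proj ∈ (chartAt H u.proj).source) (a b : E) :
    components (I := I.tangent) u w (frame w w (a, b)) =
      (fderiv ℝ (extChartAt I u.proj ∘ (extChartAt I w.proj).symm) (extChartAt I w.proj w.proj) a,
        fderiv ℝ (fderiv ℝ (extChartAt I u.proj ∘ (extChartAt I w.proj).symm))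
          (extChartAt I w.proj w.proj) a (components w.proj w.proj w.snd) +
        fderiv ℝ (extChartAt I u.proj ∘ (extChartAt I w.proj).symm)
          (extChartAt I w.proj w.proj) b) := by
  set τ := extChartAt I u.proj ∘ (extChartAt I w.proj).symm with hτ
  have hww := mem_chart_source H w.proj
  have hww' := mem_chart_source (ModelProd H E) w
  have e0 := DFunLike.congr_fun (fderiv_transition (I := I.tangent) (p := w) (q := u) (z := w) hww'
    (mem_chart_source_tangent hw)) (a, b)
  rw [ContinuousLinearMap.comp_apply] at e0
  rw [← e0]
  have cτ : ContDiffAt ℝ ∞ τ (extChartAt I w.proj w.proj) := contDiffAt_transition hww hw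
  have dτ : DifferentiableAt ℝ (fderiv ℝ τ) (extChartAt I w.proj w.proj) :=
    (cτ.fderiv_right (m := ∞) (by simp)).differentiableAt (by simp)
  have hev : (extChartAt I.tangent u ∘ (extChartAt I.tangent w).symm)
      =ᶠ[nhds (extChartAt I.tangent w w)] fun y ↦ (τ y.1, fderiv ℝ τ y.1 y.2) := by
    refine eventually_nhds_extChartAt hww' ?_
    filter_upwards [eventually_proj_mem hw, eventually_proj_mem hww] with z hz hz'
    rw [Function.comp_apply, extChartAt_symm_extChartAt (mem_chart_source_tangent hz'),
      extChartAt_tangent hz, extChartAt_tangent hz', hτ, fderiv_transition hz' hz,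
      Function.comp_apply, extChartAt_symm_extChartAt hz', ContinuousLinearMap.comp_apply,
      frame_components_of_mem hz']
  rw [hev.fderiv_eq, extChartAt_tangent hww]
  have e1 : HasFDerivAt (fun y : E × E ↦ τ y.1)
      ((fderiv ℝ τ (extChartAt I w.proj w.proj)).comp (.fst ℝ E E))
      (extChartAt I w.proj w.proj, components w.proj w.proj w.snd) :=
    HasFDerivAt.comp (g := τ) (f := Prod.fst)
      (extChartAt I w.proj w.proj, components w.proj w.proj w.snd) (cτ.differentiableAt (by simp)).hasFDerivAt hasFDerivAt_fst
  have e2 : HasFDerivAt (fun y : E × E ↦ fderiv ℝ τ y.1)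
      ((fderiv ℝ (fderiv ℝ τ) (extChartAt I w.proj w.proj)).comp (.fst ℝ E E))
      (extChartAt I w.proj w.proj, components w.proj w.proj w.snd) :=
    HasFDerivAt.comp (g := fderiv ℝ τ) (f := Prod.fst)
      (extChartAt I w.proj w.proj, components w.proj w.proj w.snd) dτ.hasFDerivAt hasFDerivAt_fst
  rw [(e1.prodMk (e2.clm_apply hasFDerivAt_snd)).fderiv]
  simp [add_comm]

theorem components_verticalLift {u w : TangentBundle I M}
    (hw : w.proj ∈ (chartAt H u.proj).source) (x : TangentSpace I w.proj) :
    components (I := I.tangent) u w (verticalLift w x) = (0, components u.proj w.proj x) := by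
  have hww := mem_chart_source H w.proj
  have h : verticalLift w x =
      frame (I := I.tangent) w w ((0, components w.proj w.proj x) : E × E) := rfl
  rw [h, components_frame_tangent hw, fderiv_transition hww hw]
  simp [frame_components]

variable [FiniteDimensional ℝ E] {g : FormField I M}

/-- The `D²τ` term from the transition map of the tangent bundle cancels the one from the law for
`Γ`, so the coordinate form of the lift holds throughout the chart. -/
theorem components_horizontalLift
    (h : ∀ p, IsMetricOn (chartMetric g p) (extChartAt I p).target) {u w : TangentBundle I M}
    (hw : w.proj ∈ (chartAt H u.proj).source) (x : TangentSpace I w.proj) :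
    components (I := I.tangent) u w (horizontalLift (leviCivita g) w x) =
      chartHor (chartMetric g u.proj) (extChartAt I.tangent u w)
        (components u.proj w.proj x) := by
  have hww := mem_chart_source H w.proj
  have hl : horizontalLift (leviCivita g) w x = frame (I := I.tangent) w w
      ((components w.proj w.proj x, -components w.proj w.proj
        (leviCivita g (FiberBundle.extend E w.snd : Π q : M, TangentSpace I q) w.proj x)) :
        E × E) := rfl
  have hc := components_leviCivita h hww (σ := (FiberBundle.extend E w.snd :
    Π q : M, TangentSpace I q)) (s := fun _ ↦ components w.proj w.proj w.snd)
    (differentiableAt_const _)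
    ((eventually_mem_chart_source hww).mono fun q hq ↦ components_extend hq w.snd) x
  rw [chartNabla, fderiv_fun_const, Pi.zero_apply, _root_.zero_apply, zero_add] at hc
  have hT := christoffel_transition h hww hw (components w.proj w.proj w.snd)
    (components w.proj w.proj x)
  have hsymm := ((contDiffAt_transition (I := I) hww hw).isSymmSndFDerivAt (by
    simp only [minSmoothness_of_isRCLikeNormedField]
    exact WithTop.coe_le_coe.2 le_top)).eq (components w.proj w.proj w.snd)
      (components w.proj w.proj x)
  rw [hl, hc, components_frame_tangent hw, map_neg, hT, ← hsymm, fderiv_transition hww hw,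
    extChartAt_tangent hw, chartHor_apply]
  simp [frame_components]

end TangentBundleChart

section LiftChart

variable {E : Type*} [NormedAddCommGroup E] [NormedSpace ℝ E] [FiniteDimensional ℝ E]
  {H : Type*} [TopologicalSpace H] {I : ModelWithCorners ℝ E H}
  {M : Type*} [TopologicalSpace M] [ChartedSpace H M] [IsManifold I ∞ M]
  {g : FormField I M} {u w : TangentBundle I M}

/-! ### The lifts in a chart of the tangent bundle -/

theorem horizontalLift_add_verticalLift (cov : CovariantDerivative I E (TangentSpace I : M → Type _))
    (u : TangentBundle I M) (ξ : TangentSpace I.tangent u) :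
    horizontalLift cov u (horizontalPart cov u ξ) + verticalLift u (verticalPart cov u ξ) = ξ :=
  (splitting cov u).apply_symm_apply ξ

theorem horizontalPart_horizontalLift (cov : CovariantDerivative I E (TangentSpace I : M → Type _))
    (u : TangentBundle I M) (x : TangentSpace I u.proj) :
    horizontalPart cov u (horizontalLift cov u x) = x :=
  congrArg Prod.fst (splitting_symm_horizontalLift cov u x)

theorem horizontalPart_verticalLift (cov : CovariantDerivative I E (TangentSpace I : M → Type _))
    (u : TangentBundle I M) (x : TangentSpace I u.proj) :
    horizontalPart cov u (verticalLift u x) = 0 :=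
  congrArg Prod.fst (splitting_symm_verticalLift cov u x)

theorem verticalPart_verticalLift (cov : CovariantDerivative I E (TangentSpace I : M → Type _))
    (u : TangentBundle I M) (x : TangentSpace I u.proj) :
    verticalPart cov u (verticalLift u x) = x :=
  congrArg Prod.snd (splitting_symm_verticalLift cov u x)

theorem completeLift_apply (g : FormField I M) (u : TangentBundle I M)
    (ξ η : TangentSpace I.tangent u) :
    completeLift g u ξ η =
      g u.proj (horizontalPart (leviCivita g) u ξ) (verticalPart (leviCivita g) u η) +
        g u.proj (verticalPart (leviCivita g) u ξ) (horizontalPart (leviCivita g) u η) := rfl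

theorem IsMetricOn.chartLift_eq {F : Type*} [NormedAddCommGroup F] [NormedSpace ℝ F]
    [FiniteDimensional ℝ F] {G : F → F →L[ℝ] F →L[ℝ] ℝ} {U : Set F} (h : IsMetricOn G U)
    {w : F × F} (hw : w.1 ∈ U) (a b : F × F) :
    AlmostNorden.chartLift G w a b =
      G w.1 a.1 (chartVertPart G w b) + G w.1 (chartVertPart G w a) b.1 := by
  simp only [chartLift_apply, chartVertPart_apply, map_add, _root_.add_apply,
    h.fderiv_eq_christoffel hw]
  ring

section Parts

variable [I.Boundaryless] (h : ∀ p, IsMetricOn (chartMetric g p) (extChartAt I p).target)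
  (hw : w.proj ∈ (chartAt H u.proj).source)

include h hw

theorem components_eq_parts (ξ : TangentSpace I.tangent w) :
    components (I := I.tangent) u w ξ =
      chartHor (chartMetric g u.proj) (extChartAt I.tangent u w)
        (components u.proj w.proj (horizontalPart (leviCivita g) w ξ)) +
      (0, components u.proj w.proj (verticalPart (leviCivita g) w ξ)) := by
  conv_lhs => rw [← horizontalLift_add_verticalLift (leviCivita g) w ξ]
  rw [map_add, components_horizontalLift h hw, components_verticalLift hw]

theorem components_fst (ξ : TangentSpace I.tangent w) :
    (components (I := I.tangent) u w ξ).1 =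
      components u.proj w.proj (horizontalPart (leviCivita g) w ξ) := by
  rw [components_eq_parts h hw]
  simp

theorem chartVertPart_components (ξ : TangentSpace I.tangent w) :
    chartVertPart (chartMetric g u.proj) (extChartAt I.tangent u w)
      (components (I := I.tangent) u w ξ) =
      components u.proj w.proj (verticalPart (leviCivita g) w ξ) := by
  rw [components_eq_parts h hw]
  simp

/-- The equality holds on the whole chart domain and not just at `u`, as is needed to differentiate
the metric. -/
theorem metricComponents_completeLift :
    metricComponents (completeLift g) u w =
      chartLift (chartMetric g u.proj) (extChartAt I.tangent u w) := by
  refine ContinuousLinearMap.ext fun a ↦ ContinuousLinearMap.ext fun b ↦ ?_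
  have hm := mem_chart_source_tangent hw
  have hwt : (extChartAt I.tangent u w).1 ∈ (extChartAt I u.proj).target := by
    rw [extChartAt_tangent hw]
    exact extChartAt_mem_target hw
  rw [metricComponents, pullForm_apply, completeLift_apply, form_eq_chartMetric g hw,
    form_eq_chartMetric g hw, ← components_fst h hw, ← components_fst h hw,
    ← chartVertPart_components h hw, ← chartVertPart_components h hw,
    components_frame_of_mem hm, components_frame_of_mem hm, (h u.proj).chartLift_eq hwt,
    extChartAt_tangent hw]

theorem components_liftJ₁ (A : EndField I M) (ξ : TangentSpace I.tangent w) :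
    components (I := I.tangent) u w (liftJ₁ g A w ξ) =
      chartLift₁ (chartMetric g u.proj) (chartEnd A u.proj) (extChartAt I.tangent u w)
        (components (I := I.tangent) u w ξ) := by
  have e : liftJ₁ g A w ξ =
      -horizontalLift (leviCivita g) w (A w.proj (horizontalPart (leviCivita g) w ξ)) +
        verticalLift w (A w.proj (verticalPart (leviCivita g) w ξ)) := rfl
  have e' : ∀ (G : E → E →L[ℝ] E →L[ℝ] ℝ) (B : E → E →L[ℝ] E) (z a : E × E), chartLift₁ G B z a =
      -chartHor G z (B z.1 a.1) + (0, B z.1 (chartVertPart G z a)) := fun _ _ _ _ ↦ rfl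
  rw [e, e', components_fst h hw, chartVertPart_components h hw, map_add, map_neg,
    components_horizontalLift h hw, components_verticalLift hw, components_end A hw,
    components_end A hw]
  simp only [extChartAt_tangent hw]

theorem components_liftJ₂ (ξ : TangentSpace I.tangent w) :
    components (I := I.tangent) u w (liftJ₂ g w ξ) =
      chartLift₂ (chartMetric g u.proj) (extChartAt I.tangent u w)
        (components (I := I.tangent) u w ξ) := by
  have e : liftJ₂ g w ξ = verticalLift w (horizontalPart (leviCivita g) w ξ) -
      horizontalLift (leviCivita g) w (verticalPart (leviCivita g) w ξ) := rfl
  have e' : ∀ (G : E → E →L[ℝ] E →L[ℝ] ℝ) (z a : E × E), chartLift₂ G z a =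
      (0, a.1) - chartHor G z (chartVertPart G z a) := fun _ _ _ ↦ rfl
  rw [e, e', components_fst h hw, chartVertPart_components h hw, map_sub,
    components_horizontalLift h hw, components_verticalLift hw]

theorem components_liftJ₃ (A : EndField I M) (ξ : TangentSpace I.tangent w) :
    components (I := I.tangent) u w (liftJ₃ g A w ξ) =
      chartLift₃ (chartMetric g u.proj) (chartEnd A u.proj) (extChartAt I.tangent u w)
        (components (I := I.tangent) u w ξ) := by
  have e : liftJ₃ g A w ξ = verticalLift w (A w.proj (horizontalPart (leviCivita g) w ξ)) +
      horizontalLift (leviCivita g) w (A w.proj (verticalPart (leviCivita g) w ξ)) := rfl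
  have e' : ∀ (G : E → E →L[ℝ] E →L[ℝ] ℝ) (B : E → E →L[ℝ] E) (z a : E × E), chartLift₃ G B z a =
      (0, B z.1 a.1) + chartHor G z (B z.1 (chartVertPart G z a)) := fun _ _ _ _ ↦ rfl
  rw [e, e', components_fst h hw, chartVertPart_components h hw, map_add,
    components_horizontalLift h hw, components_verticalLift hw, components_end A hw,
    components_end A hw]
  simp only [extChartAt_tangent hw]

end Parts

end LiftChart

section LeeForms

variable {E : Type*} [NormedAddCommGroup E] [NormedSpace ℝ E] [FiniteDimensional ℝ E]
  {H : Type*} [TopologicalSpace H] {I : ModelWithCorners ℝ E H} [I.Boundaryless]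
  {M : Type*} [TopologicalSpace M] [ChartedSpace H M] [IsManifold I ∞ M]
  (S : AlmostNordenStructure I M)

/-! ### The Lee forms of the lifts -/

namespace AlmostNordenStructure

theorem structureTensor_eq_chart (p : M) (x y z : TangentSpace I p) :
    structureTensor S.g S.J p x y z = chartMetric S.g p (extChartAt I p p)
      (chartNablaEnd (chartMetric S.g p) (chartEnd S.J p) (extChartAt I p p) (components p p x)
        (components p p y)) (components p p z) :=
  form_covDerivEnd ((S.isMetricOn p).differentiableAt (mem_extChartAt_target p))
    (eventually_chartMetric S.g p) (S.differentiableAt_chartEnd p) (by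
      filter_upwards [eventually_mem_chart_source (mem_chart_source H p)] with z hz b
      rw [components_end S.J hz, components_frame_of_mem hz]) x y z

theorem curvatureTensor_eq_chart (p : M) (x y z w : TangentSpace I p) :
    curvatureTensor S.g p x y z w = chartMetric S.g p (extChartAt I p p)
      (chartCurvature (chartMetric S.g p) (extChartAt I p p) (components p p x)
        (components p p y) (components p p z)) (components p p w) := by
  rw [curvatureTensor, form_eq_chartMetric S.g (mem_chart_source H p),
    components_curvature S.isMetricOn]

/-- Common to the three structures: the trace is split along `H ⊕ V` and each half is written in the
coordinates of the base. -/
theorem leeForm_lift (u : TangentBundle I M) {A : EndField I.tangent (TangentBundle I M)}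
    {B : E × E → E × E →L[ℝ] E × E} (dB : DifferentiableAt ℝ B (extChartAt I.tangent u u))
    (hB : ∀ w : TangentBundle I M, w.proj ∈ (chartAt H u.proj).source → ∀ ξ,
      components (I := I.tangent) u w (A w ξ) =
        B (extChartAt I.tangent u w) (components (I := I.tangent) u w ξ))
    (ζ : TangentSpace I.tangent u) :
    leeForm (completeLift S.g) A u ζ =
      metricTrace (S.g u.proj) (fun x y ↦
        chartLift (chartMetric S.g u.proj) (extChartAt I.tangent u u)
          (chartNablaEnd (chartLift (chartMetric S.g u.proj)) B (extChartAt I.tangent u u)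
            (chartHor (chartMetric S.g u.proj) (extChartAt I.tangent u u)
              (components u.proj u.proj x)) (0, components u.proj u.proj y))
          (components (I := I.tangent) u u ζ)) +
      metricTrace (S.g u.proj) (fun x y ↦
        chartLift (chartMetric S.g u.proj) (extChartAt I.tangent u u)
          (chartNablaEnd (chartLift (chartMetric S.g u.proj)) B (extChartAt I.tangent u u)
            (0, components u.proj u.proj x)
            (chartHor (chartMetric S.g u.proj) (extChartAt I.tangent u u)
              (components u.proj u.proj y)))
          (components (I := I.tangent) u u ζ)) := by
  have hu := mem_chart_source H u.proj
  have hut : extChartAt I.tangent u u ∈ (extChartAt I u.proj).target ×ˢ (Set.univ : Set E) := by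
    rw [extChartAt_tangent hu]
    exact ⟨mem_extChartAt_target u.proj, trivial⟩
  set N := chartNablaEnd (chartLift (chartMetric S.g u.proj)) B (extChartAt I.tangent u u) with hN
  set G := chartLift (chartMetric S.g u.proj) (extChartAt I.tangent u u) with hG
  set c := components (I := I.tangent) u u with hc
  have hst : ∀ ξ η, structureTensor (completeLift S.g) A u ξ η ζ = G (N (c ξ) (c η)) (c ζ) :=
    fun ξ η ↦ form_covDerivEnd ((S.isMetricOn u.proj).chartLift.differentiableAt hut)
      ((eventually_proj_mem hu).mono fun w hw ↦ metricComponents_completeLift S.isMetricOn hw)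
      dB ((eventually_proj_mem hu).mono fun w hw b ↦ by
        rw [hB w hw, components_frame_of_mem (mem_chart_source_tangent hw)]) ξ η ζ
  let T : TangentSpace I.tangent u →ₗ[ℝ] TangentSpace I.tangent u →ₗ[ℝ] ℝ :=
    LinearMap.mk₂ ℝ (fun ξ η ↦ G (N (c ξ) (c η)) (c ζ)) (by simp) (by simp) (by simp) (by simp)
  have hΦ : ∀ a b, completeLift S.g u (splitting (leviCivita S.g) u a)
      (splitting (leviCivita S.g) u b) =
        S.g u.proj a.1 b.2 + S.g u.proj a.2 b.1 := fun a b ↦ by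
    rw [completeLift_apply]
    simp only [horizontalPart, verticalPart, ContinuousLinearMap.comp_apply,
      ContinuousLinearEquiv.coe_coe, ContinuousLinearEquiv.symm_apply_apply,
      ContinuousLinearMap.coe_fst', ContinuousLinearMap.coe_snd']
  have main := metricTrace_prod (S.g_symm u.proj) (S.g_nondegenerate u.proj)
    (g' := completeLift S.g u) (splitting (leviCivita S.g) u).toLinearEquiv hΦ T
  have hH : ∀ x, c (splitting (leviCivita S.g) u (x, 0)) = chartHor (chartMetric S.g u.proj)
      (extChartAt I.tangent u u) (components u.proj u.proj x) := fun x ↦ by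
    rw [splitting_apply, map_zero, add_zero, hc, components_horizontalLift S.isMetricOn hu]
  have hV : ∀ x, c (splitting (leviCivita S.g) u (0, x)) = (0, components u.proj u.proj x) :=
    fun x ↦ by rw [splitting_apply, map_zero, zero_add, hc, components_verticalLift hu]
  simp only [T, LinearMap.mk₂_apply, ContinuousLinearEquiv.coe_toLinearEquiv, hH, hV] at main
  rw [leeForm]
  simp only [hst]
  exact main

variable (u : TangentBundle I M) (ζ : TangentSpace I.tangent u)

theorem leeForm_liftJ₁ :
    leeForm (completeLift S.g) (liftJ₁ S.g S.J) u ζ =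
      leeForm S.g S.J u.proj (horizontalPart (leviCivita S.g) u ζ) := by
  have hu := mem_chart_source H u.proj
  have h := S.isMetricOn u.proj
  have e := extChartAt_tangent hu
  have h1 : (extChartAt I.tangent u u).1 = extChartAt I u.proj u.proj := by rw [e]
  have hw : (extChartAt I.tangent u u).1 ∈ (extChartAt I u.proj).target := by
    rw [h1]
    exact mem_extChartAt_target u.proj
  have dJ : DifferentiableAt ℝ (chartEnd S.J u.proj) (extChartAt I.tangent u u).1 := by
    rw [h1]
    exact S.differentiableAt_chartEnd u.proj
  rw [S.leeForm_lift u (h.differentiableAt_chartLift₁ hw dJ)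
    (fun w hw ξ ↦ components_liftJ₁ S.isMetricOn hw S.J ξ)]
  simp only [h.nablaEnd_lift₁_hor_vert hw dJ, h.nablaEnd_lift₁_vert_hor hw dJ, chartLift_vertical,
    components_fst S.isMetricOn hu, map_zero, _root_.zero_apply, metricTrace_zero, add_zero, h1,
    ← S.structureTensor_eq_chart]
  rfl

theorem leeForm_liftJ₂ :
    leeForm (completeLift S.g) (liftJ₂ S.g) u ζ =
      -ricci S.g u.proj u.snd (horizontalPart (leviCivita S.g) u ζ) := by
  have hu := mem_chart_source H u.proj
  have h := S.isMetricOn u.proj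
  have e := extChartAt_tangent hu
  have h1 : (extChartAt I.tangent u u).1 = extChartAt I u.proj u.proj := by rw [e]
  have h2 : (extChartAt I.tangent u u).2 = components u.proj u.proj u.snd := by rw [e]
  have hw : (extChartAt I.tangent u u).1 ∈ (extChartAt I u.proj).target := by
    rw [h1]
    exact mem_extChartAt_target u.proj
  have hw' := hw
  rw [h1] at hw'
  rw [S.leeForm_lift u (h.differentiableAt_chartLift₂ hw)
    (fun w hw ξ ↦ components_liftJ₂ S.isMetricOn hw ξ)]
  simp only [h.nablaEnd_lift₂_hor_vert hw, h.nablaEnd_lift₂_vert_hor hw, chartLift_vertical,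
    components_fst S.isMetricOn hu, map_zero, _root_.zero_apply, metricTrace_zero, add_zero, h1, h2]
  rw [ricci, ← metricTrace_neg]
  congr 1
  funext x y
  -- The identity is `R(u, x, y, z) = R(x, u, z, y)`, from skew symmetry in each of the two pairs.
  rw [S.curvatureTensor_eq_chart, chartCurvature_swap, neg_neg, h.curvature_skew hw']

theorem leeForm_liftJ₃ :
    leeForm (completeLift S.g) (liftJ₃ S.g S.J) u ζ =
      leeForm S.g S.J u.proj (verticalPart (leviCivita S.g) u ζ) +
        associatedRicci S.g S.J u.proj u.snd (horizontalPart (leviCivita S.g) u ζ) := by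
  have hu := mem_chart_source H u.proj
  have h := S.isMetricOn u.proj
  have e := extChartAt_tangent hu
  have h1 : (extChartAt I.tangent u u).1 = extChartAt I u.proj u.proj := by rw [e]
  have h2 : (extChartAt I.tangent u u).2 = components u.proj u.proj u.snd := by rw [e]
  have hw : (extChartAt I.tangent u u).1 ∈ (extChartAt I u.proj).target := by
    rw [h1]
    exact mem_extChartAt_target u.proj
  have hw' := hw
  rw [h1] at hw'
  have dJ : DifferentiableAt ℝ (chartEnd S.J u.proj) (extChartAt I.tangent u u).1 := by
    rw [h1]
    exact S.differentiableAt_chartEnd u.proj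
  rw [S.leeForm_lift u (h.differentiableAt_chartLift₃ hw dJ)
    (fun w hw ξ ↦ components_liftJ₃ S.isMetricOn hw S.J ξ)]
  simp only [h.nablaEnd_lift₃_hor_vert hw dJ, h.nablaEnd_lift₃_vert_hor hw dJ, chartLift_vertical,
    components_fst S.isMetricOn hu, map_zero, _root_.zero_apply, metricTrace_zero, add_zero,
    map_add, _root_.add_apply, h.chartLift_chartHor hw, chartVertPart_components S.isMetricOn hu,
    metricTrace_add, h1, h2, ← S.structureTensor_eq_chart]
  rw [leeForm, associatedRicci]
  congr 2
  funext x y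
  rw [S.curvatureTensor_eq_chart, components_end S.J hu, h.curvature_skew hw',
    chartCurvature_swap, map_neg, _root_.neg_apply, neg_neg]

theorem associatedRicci_zero (p : M) (y : TangentSpace I p) :
    associatedRicci S.g S.J p y 0 = 0 := by
  simp only [associatedRicci, S.curvatureTensor_eq_chart]
  simp [chartCurvature, metricTrace_zero]

end AlmostNordenStructure

end LeeForms

end AlmostNorden

end

/-! ### The three equivalences -/

theorem mainTheorem8 {E : Type*} [NormedAddCommGroup E] [NormedSpace ℝ E] [FiniteDimensional ℝ E]
    {M : Type*} [TopologicalSpace M] [ChartedSpace E M] [IsManifold 𝓘(ℝ, E) ∞ M]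
    (S : AlmostNorden.AlmostNordenStructure 𝓘(ℝ, E) M) :
    ((∀ u ξ, AlmostNorden.leeForm (AlmostNorden.completeLift S.g)
        (AlmostNorden.liftJ₁ S.g S.J) u ξ = 0) ↔
      ∀ p z, AlmostNorden.leeForm S.g S.J p z = 0) ∧
    ((∀ u ξ, AlmostNorden.leeForm (AlmostNorden.completeLift S.g)
        (AlmostNorden.liftJ₂ S.g) u ξ = 0) ↔
      ∀ p y z, AlmostNorden.ricci S.g p y z = 0) ∧
    ((∀ u ξ, AlmostNorden.leeForm (AlmostNorden.completeLift S.g)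
        (AlmostNorden.liftJ₃ S.g S.J) u ξ = 0) ↔
      (∀ p z, AlmostNorden.leeForm S.g S.J p z = 0) ∧
        ∀ p y z, AlmostNorden.associatedRicci S.g S.J p y z = 0) := by
  refine ⟨?_, ?_, ?_⟩
  · simp only [S.leeForm_liftJ₁]
    refine ⟨fun h p z ↦ ?_, fun h u ξ ↦ h _ _⟩
    -- Here `θ₁` depends on `u` only through its base point, so the zero vector serves.
    have := h ⟨p, 0⟩ (AlmostNorden.horizontalLift (AlmostNorden.leviCivita S.g) _ z)
    rwa [AlmostNorden.horizontalPart_horizontalLift] at this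
  · simp only [S.leeForm_liftJ₂, neg_eq_zero]
    refine ⟨fun h p y z ↦ ?_, fun h u ξ ↦ h _ _ _⟩
    have := h ⟨p, y⟩ (AlmostNorden.horizontalLift (AlmostNorden.leviCivita S.g) _ z)
    rwa [AlmostNorden.horizontalPart_horizontalLift] at this
  · simp only [S.leeForm_liftJ₃]
    have hθ (h : ∀ (u : TangentBundle 𝓘(ℝ, E) M) (ξ : TangentSpace 𝓘(ℝ, E).tangent u),
        AlmostNorden.leeForm S.g S.J u.proj (AlmostNorden.verticalPart
          (AlmostNorden.leviCivita S.g) u ξ) + AlmostNorden.associatedRicci S.g S.J u.proj u.snd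
            (AlmostNorden.horizontalPart (AlmostNorden.leviCivita S.g) u ξ) = 0)
        (p : M) (z : TangentSpace 𝓘(ℝ, E) p) : AlmostNorden.leeForm S.g S.J p z = 0 := by
      -- Vertical vectors make the `ρ*` term vanish and isolate `θ`; horizontal vectors at `u = y`
      -- then isolate `ρ*(y, z)`.
      have := h ⟨p, 0⟩ (AlmostNorden.verticalLift _ z)
      rwa [AlmostNorden.verticalPart_verticalLift, AlmostNorden.horizontalPart_verticalLift,
        S.associatedRicci_zero, add_zero] at this
    refine ⟨fun h ↦ ⟨hθ h, fun p y z ↦ ?_⟩, fun h u ξ ↦ by rw [h.1, h.2, add_zero]⟩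
    have := h ⟨p, y⟩ (AlmostNorden.horizontalLift (AlmostNorden.leviCivita S.g) _ z)
    rwa [AlmostNorden.horizontalPart_horizontalLift, hθ h, zero_add] at this
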